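/- **Setting.** Let $k$ be an infinite field, $R=k[x_1,\dots,x_r]$ and $S=k[y_1,\dots,y_r]$. Let $R$ act on $S$ either by differentiation ($x_j$ acts as $\partial/\partial y_j$), or by contraction ($x_j$ divides by $y_j$ each monomial divisible by $y_j$ and kills the others; the monomials of $S$ then play the role of divided powers). Fix integers $e\ge 0$, $t\ge 2$ and $1\le c\le t-1$. In the case of differentiation assume that $k$ has characteristic $0$ or characteristic $p>e$; for contraction the characteristic is arbitrary, and "partial derivative" below means the action of a monomial of $R$. For a homogeneous ideal $I\subseteq R$ the $h$-vector of $A=R/I$ is given by $h_u=\dim_kA_u$. The algebra $A$ is *level of socle degree $e$ and type $t$* if it is artinian, $e$ is the last index with $A_e\ne0$, and its socle $\{a\in A: a\,(\overline{x_1},\dots,\overline{x_r})=0\}$ has dimension $t$ in degree $e$ and $0$ in all other degrees. **Theorem 2.9 (Main Theorem).** (i) Let $A=R/I$ be an artinian level algebra of type $t$, socle degree $e$ and $h$-vector $h$. Then there are forms $F_1,\dots,F_t\in S$ of degree $e$ such that $I$ is the annihilator of the $R$-module they generate in $S$. For every such choice, and for a point $x=([a_1],\dots,[a_c])\in(\mathbb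 P^{t-1}(k))^c$, put $G_l=\sum_j a_{lj}F_j$ and $A_x=R/\mathrm{Ann}(G_1,\dots,G_c)$. There are a vector $H^{c,gen}=(H_0^{c,gen},\dots,H_e^{c,gen})$ and a non-empty Zariski open subset of $(\mathbb P^{t-1}(k))^c$ such that, for all $x$ in it, $A_x$ is a level quotient of $A$ of type $c$ and socle degree $e$ with $h$-vector $H^{c,gen}$. For every such vector and every $0\le u\le e$, $$H_u^{c,gen}\ \ge\ \frac{(t-c)\,h_{e-u}+(ct-1)\,h_u}{t^2-1}.$$ In particular, for $c=t-1$, $$H_u^{t-1,gen}\ \ge\ \frac{h_{e-u}+(t^2-t-1)\,h_u}{t^2-1}.$$ Moreover, for $0\le u\le e$, $h_u$ is the dimension of the space spanned by the partial derivatives of order $e-u$ of the elements of $\langle F_1,\dots,F_t\rangle_k$, and $H^{c,gen}_u$ is the dimension of the space spanned by the partial derivatives of order $e-u$ of the elements of a generic $c$-dimensional subspace of $\langle F_1,\dots,F_t\rangle_k$, in the sense of (ii). (ii) Equivalently, in terms of partial derivatives: let $V\subseteq S$ be a $t$-dimensional space of forms of degree $e$ with basis $F_1,\dots,F_t$, and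 for $0\le u\le e$ let $h_u$ be the dimension of the space spanned by the partial derivatives of order $e-u$ of the elements of $V$. There are integers $H_0^{c,gen},\dots,H_e^{c,gen}$ and a non-empty Zariski open subset of $(\mathbb P^{t-1}(k))^c$ such that, for all $x$ in it, $W_x=\langle G_1,\dots,G_c\rangle_k$ has dimension $c$ and, for all $0\le u\le e$, the partial derivatives of order $e-u$ of the elements of $W_x$ span a space of dimension $H_u^{c,gen}$. For all such integers, the same two inequalities hold for every $0\le u\le e$. -/

import Mathlib

open MvPolynomial

noncomputable section

namespace LevelAlgebra

/-! ### Graded quotients of polynomial rings: `h`-vector, socle, level algebras -/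

section Quotients

attribute [local instance] MvPolynomial.gradedAlgebra

variable {k : Type*} [Field k] {r : ℕ}

/-- The degree `u` piece `A_u` of `A = R/I`, `R = k[x_1, …, x_r]`: the image of the forms of
degree `u`. -/
def gradedPiece (I : Ideal (MvPolynomial (Fin r) k)) (u : ℕ) :
    Submodule k (MvPolynomial (Fin r) k ⧸ I) :=
  (homogeneousSubmodule (Fin r) k u).map (Ideal.Quotient.mkₐ k I).toLinearMap

/-- The `h`-vector of `A = R/I`: `h_u = dim_k A_u`. -/
def hVector (I : Ideal (MvPolynomial (Fin r) k)) (u : ℕ) : ℕ :=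
  Module.finrank k (gradedPiece I u)

/-- The ideal of `A = R/I` generated by the classes of the variables `x_1, …, x_r`. -/
def maxHomogeneousIdeal (I : Ideal (MvPolynomial (Fin r) k)) :
    Ideal (MvPolynomial (Fin r) k ⧸ I) :=
  Ideal.span (Set.range fun j : Fin r => Ideal.Quotient.mk I (X j))

/-- The socle of `A = R/I`: the annihilator in `A` of the maximal homogeneous ideal. -/
def socle (I : Ideal (MvPolynomial (Fin r) k)) : Ideal (MvPolynomial (Fin r) k ⧸ I) :=
  (maxHomogeneousIdeal I).annihilator

/-- The socle-vector of `A = R/I`: `s_u = dim_k soc(A)_u`. -/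
def socleVector (I : Ideal (MvPolynomial (Fin r) k)) (u : ℕ) : ℕ :=
  Module.finrank k ((socle I).restrictScalars k ⊓ gradedPiece I u : Submodule k _)

/-- `A = R/I` is a standard graded artinian level algebra of socle degree `e` and type `t`:
`I` is homogeneous, `A` is artinian, `e` is the last index with `A_e ≠ 0`, and the socle-vector
is `(0, …, 0, t)`. -/
structure IsLevel (I : Ideal (MvPolynomial (Fin r) k)) (e t : ℕ) : Prop where
  homogeneous : I.IsHomogeneous (homogeneousSubmodule (Fin r) k)
  artinian : IsArtinianRing (MvPolynomial (Fin r) k ⧸ I)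
  top_ne : hVector I e ≠ 0
  above : ∀ u, e < u → hVector I u = 0
  socle_top : socleVector I e = t
  socle_other : ∀ u, u ≠ e → socleVector I u = 0

end Quotients

/-! ### The action of `R = k[x_1, …, x_r]` on `S = k[y_1, …, y_r]` -/

/-- The two standard actions of `R` on `S` used for inverse systems. -/
inductive DualityAction
  /-- `x_j` acts as the partial derivative with respect to `y_j`. -/
  | differentiation
  /-- `x_j` acts as contraction by `y_j`; here the monomials of `S` stand for the divided
  powers. -/
  | contraction

variable {k : Type*} [Field k] {r : ℕ}

/-- Contraction by `y_j`: a monomial divisible by `y_j` is divided by it, every other monomial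
is sent to `0`. -/
def contract (j : Fin r) : Module.End k (MvPolynomial (Fin r) k) where
  toFun G := G.divMonomial (Finsupp.single j 1)
  map_add' G G' := add_divMonomial G G' _
  map_smul' a G := by
    ext m
    simp [coeff_divMonomial]

/-- The operator on `S` by which the variable `x_j` acts. -/
def op (κ : DualityAction) (j : Fin r) : Module.End k (MvPolynomial (Fin r) k) :=
  match κ with
  | .differentiation => (pderiv j).toLinearMap
  | .contraction => contract j

theorem op_commute (κ : DualityAction) (i j : Fin r) :
    Commute (op (k := k) κ i) (op κ j) := by
  cases κ with
  | differentiation =>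
    have h : ⁅pderiv (R := k) i, pderiv (R := k) j⁆ = 0 := by
      apply derivation_ext
      intro l
      simp [Derivation.commutator_apply, pderiv_X, Pi.single_apply, apply_ite]
    refine LinearMap.ext fun G => ?_
    have h' := congrArg (fun D => D G) h
    simpa [Derivation.commutator_apply, sub_eq_zero, op] using h'
  | contraction =>
    refine LinearMap.ext fun G => ?_
    change (G.divMonomial _).divMonomial _ = (G.divMonomial _).divMonomial _
    rw [← divMonomial_add, ← divMonomial_add, add_comm]

/-- The operator by which the monomial `x_1^{n_1} ⋯ x_r^{n_r}` acts: for `differentiation` this is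
the iterated partial derivative `∂_1^{n_1} ⋯ ∂_r^{n_r}`, of order `n_1 + ⋯ + n_r`. -/
def monomialOp (κ : DualityAction) (n : Fin r →₀ ℕ) : Module.End k (MvPolynomial (Fin r) k) :=
  ((List.finRange r).map fun j => op κ j ^ n j).prod

theorem monomialOp_zero (κ : DualityAction) : monomialOp (k := k) (r := r) κ 0 = 1 := by
  simp [monomialOp]

theorem monomialOp_add (κ : DualityAction) (m n : Fin r →₀ ℕ) :
    monomialOp (k := k) κ (m + n) = monomialOp κ m * monomialOp κ n := by
  unfold monomialOp
  induction List.finRange r with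
  | nil => simp
  | cons a l ih =>
    have hc : Commute (op (k := k) κ a ^ n a) (l.map fun j => op κ j ^ m j).prod := by
      apply Commute.list_prod_right
      intro x hx
      obtain ⟨j, -, rfl⟩ := List.mem_map.1 hx
      exact (op_commute κ a j).pow_pow _ _
    rw [List.map_cons, List.prod_cons, ih, List.map_cons, List.prod_cons, List.map_cons,
      List.prod_cons, Finsupp.add_apply, pow_add, mul_assoc, ← mul_assoc (op κ a ^ n a), hc.eq]
    simp only [mul_assoc]

/-- The action of `R` on `S`: `∑ a_n x^n` acts as `∑ a_n • monomialOp κ n`. -/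
def act (κ : DualityAction) :
    MvPolynomial (Fin r) k →ₐ[k] Module.End k (MvPolynomial (Fin r) k) :=
  AddMonoidAlgebra.lift k (Module.End k (MvPolynomial (Fin r) k)) (Fin r →₀ ℕ)
    { toFun := fun n => monomialOp κ n.toAdd
      map_one' := monomialOp_zero κ
      map_mul' := fun m n => monomialOp_add κ m.toAdd n.toAdd }

theorem act_apply (κ : DualityAction) (p G : MvPolynomial (Fin r) k) :
    act κ p G = ∑ n ∈ p.support, p.coeff n • monomialOp κ n G := by
  rw [act, AddMonoidAlgebra.lift_apply, Finsupp.sum, LinearMap.sum_apply]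
  rfl

/-! ### Inverse systems -/

/-- The `R`-submodule `⟨G_1, …, G_s⟩` of `S` generated by a family of polynomials. -/
def inverseModule {s : ℕ} (κ : DualityAction) (G : Fin s → MvPolynomial (Fin r) k) :
    Submodule k (MvPolynomial (Fin r) k) :=
  Submodule.span k {Q | ∃ p j, Q = act κ p (G j)}

/-- The annihilator in `R` of a subspace of `S`. -/
def Ann (κ : DualityAction) (M : Submodule k (MvPolynomial (Fin r) k)) :
    Ideal (MvPolynomial (Fin r) k) where
  carrier := {p | ∀ Q ∈ M, act κ p Q = 0}
  add_mem' := fun ha hb Q hQ => by simp [ha Q hQ, hb Q hQ]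
  zero_mem' := fun Q _ => by simp
  smul_mem' := fun p q hq Q hQ => by simp [hq Q hQ]

/-- `F_1, …, F_t` are forms of degree `e` whose `R`-module `M = ⟨F_1, …, F_t⟩` is the inverse
system of `A = R/I`, i.e. `I = Ann(M)`. -/
def IsInverseSystemGenerators {t : ℕ} (κ : DualityAction) (I : Ideal (MvPolynomial (Fin r) k))
    (e : ℕ) (F : Fin t → MvPolynomial (Fin r) k) : Prop :=
  (∀ j, (F j).IsHomogeneous e) ∧ Ann κ (inverseModule κ F) = I

/-- The space spanned by the partial derivatives of order `i` of the elements of `V`. -/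
def derivSpace (κ : DualityAction) (V : Submodule k (MvPolynomial (Fin r) k)) (i : ℕ) :
    Submodule k (MvPolynomial (Fin r) k) :=
  Submodule.span k {Q | ∃ n : Fin r →₀ ℕ, n.degree = i ∧ ∃ G ∈ V, Q = monomialOp κ n G}

/-- For a space `V` of forms of degree `e` and `u ≤ e`: the dimension of the space of forms of
degree `u` spanned by the partial derivatives of order `e - u` of the elements of `V`. -/
def derivDim (κ : DualityAction) (e : ℕ) (V : Submodule k (MvPolynomial (Fin r) k)) (u : ℕ) : ℕ :=
  Module.finrank k (derivSpace κ V (e - u))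

/-! ### Genericity -/

/-- Zariski open subsets of `(ℙ^{t-1}(k))^c`: complements of the common zero loci of families of
multihomogeneous polynomials. (Whether a multihomogeneous polynomial vanishes at a point does not
depend on the representatives of its components.) -/
def IsZariskiOpen {c t : ℕ} (U : Set (Fin c → Projectivization k (Fin t → k))) : Prop :=
  ∃ P : Set (MvPolynomial (Fin c × Fin t) k),
    (∀ f ∈ P, ∃ d : Fin c → ℕ,
      IsWeightedHomogeneous (fun q : Fin c × Fin t => (Pi.single q.1 1 : Fin c → ℕ)) f d) ∧
    U = {x | ∃ f ∈ P, eval (fun q : Fin c × Fin t => (x q.1).rep q.2) f ≠ 0}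

/-- The `c` forms `G_l = ∑_j a_{l j} F_j` given by a point `([a_1], …, [a_c])` of
`(ℙ^{t-1}(k))^c`; each is well defined up to a non-zero scalar. -/
def formsAt {c t : ℕ} (F : Fin t → MvPolynomial (Fin r) k)
    (x : Fin c → Projectivization k (Fin t → k)) (l : Fin c) : MvPolynomial (Fin r) k :=
  ∑ j, (x l).rep j • F j

/-- `H` is the `h`-vector of the generic level quotient of type `c` and socle degree `e` of
`A = R/I`, where `F_1, …, F_t` generate the inverse system of `A`: at all points of some non-empty
Zariski open subset of `(ℙ^{t-1}(k))^c`, the forms `G_1, …, G_c` define a level quotient of `A` of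
type `c` and socle degree `e` with `h`-vector `H`. -/
def IsGenericHVector {t : ℕ} (κ : DualityAction) (I : Ideal (MvPolynomial (Fin r) k)) (e c : ℕ)
    (F : Fin t → MvPolynomial (Fin r) k) (H : ℕ → ℕ) : Prop :=
  ∃ U : Set (Fin c → Projectivization k (Fin t → k)), IsZariskiOpen U ∧ U.Nonempty ∧
    ∀ x ∈ U,
      I ≤ Ann κ (inverseModule κ (formsAt F x)) ∧
      IsLevel (Ann κ (inverseModule κ (formsAt F x))) e c ∧
      ∀ u, hVector (Ann κ (inverseModule κ (formsAt F x))) u = H u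

/-- `H_0, …, H_e` are the dimensions of the spaces of partial derivatives, in degrees `0, …, e`, of
the generic `c`-dimensional subspace `W` of the span of the forms `F_1, …, F_t` of degree `e`. -/
def IsGenericDerivVector {t : ℕ} (κ : DualityAction) (e c : ℕ)
    (F : Fin t → MvPolynomial (Fin r) k) (H : ℕ → ℕ) : Prop :=
  ∃ U : Set (Fin c → Projectivization k (Fin t → k)), IsZariskiOpen U ∧ U.Nonempty ∧
    ∀ x ∈ U,
      Module.finrank k (Submodule.span k (Set.range (formsAt F x))) = c ∧
      ∀ u ≤ e, derivDim κ e (Submodule.span k (Set.range (formsAt F x))) u = H u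

end LevelAlgebra

end

/-!
Fix `u` and let `X` be the space of forms of degree `e - u` in `R`. The action of `R` on `S` gives a
linear map `M` from `k^t` to the linear maps `X → S`, sending `a` to `p ↦ p ∘ ∑ a_j F_j`. The dimension
of the space of derivatives of order `e - u` of `⟨G_1, …, G_c⟩` is the rank of the block row formed by
the maps `M a_1, …, M a_c`, that is, the dimension of the sum of their images (`familyRank`).

*Genericity.* Some minor shows that this rank is lower semicontinuous (`exists_familyRank_le`), so on a
non-empty Zariski open set it takes its maximal value `ρ c`; since `k` is infinite, any two non-empty
Zariski open sets meet, and every generic vector `H` has `H u = ρ c`.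

*The inequality.* Let `a = ρ t` and let `b` be the rank of the block column with the same entries,
that is, the codimension in `X` of the common kernel of all `M v`. For `A = M v` of maximal rank
`ρ 1` and any `B = M v'`, no map of the pencil of `A` and `B` has larger rank than `A`; this
forces `rank (A B) + rank (A; B) ≤ 3 ρ 1` (`finrank_range_sup_add_le`). Adding the other basis
vectors one at a time gives `a + b ≤ (t + 1) ρ 1`. As `ρ` is concave, by submodularity of the
dimension of sums of subspaces, `(t - 1) ρ c ≥ (t - c) ρ 1 + (c - 1) a`. Together these are the
bound (`generic_familyRank_bound`).

*Inverse systems.* Under the assumption on the characteristic, forms of degree `u ≤ e` in `R` and in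
`S` are dual to each other, and the derivatives of order `e - u` of `F_1, …, F_t` are the orthogonal
space of the forms of degree `u` annihilating all `F_j` (`derivDim_add_finrank_ker`). So
the `h`-vector of the annihilator consists of dimensions of spaces of derivatives (`hVector_Ann`), and
`b` is the dimension of the space of derivatives of order `u`. Independent forms of degree `e`
give level algebras (`isLevel_Ann`), and every level algebra arises from a basis of the space
orthogonal to the degree `e` part of its ideal (`IsLevel.exists_generators`).
-/

open MvPolynomial

noncomputable section

namespace LevelAlgebra

/-! ### Generic rank -/

section Generic

variable {k : Type*} [Field k]

/-- Linear independence is a Zariski open condition: if vectors depend linearly on parameters, some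
minor of their coordinate matrix survives at a point where they are independent. The minor is
homogeneous for every weight for which each vector involves parameters of one weight only. -/
theorem exists_minor {σ ι N Y : Type*} [Fintype σ] [DecidableEq σ] [Fintype ι] [AddCommMonoid N]
    [AddCommGroup Y] [Module k Y] (w : σ → N) (wt : ι → N) (L : ι → (σ → k) →ₗ[k] Y)
    (hL : ∀ i q, w q ≠ wt i → L i (Pi.single q 1) = 0) (a₀ : σ → k)
    (h₀ : LinearIndependent k fun i => L i a₀) :
    ∃ f : MvPolynomial σ k, IsWeightedHomogeneous w f (∑ i, wt i) ∧ eval a₀ f ≠ 0 ∧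
      ∀ a, eval a f ≠ 0 → LinearIndependent k fun i => L i a := by
  classical
  obtain ⟨g, hg⟩ := LinearMap.exists_leftInverse_of_injective
    (Fintype.linearCombination k fun i => L i a₀) (LinearMap.ker_eq_bot.2
      (linearIndependent_iff_injective_fintypeLinearCombination.1 h₀))
  have hg' : ∀ i, g (L i a₀) = Pi.single i 1 := fun i => by
    have := LinearMap.congr_fun hg (Pi.single i 1)
    simpa [Fintype.linearCombination_apply_single] using this
  let A : Matrix ι ι (MvPolynomial σ k) :=
    Matrix.of fun i j => ∑ q, C (g (L i (Pi.single q 1)) j) * X q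
  have hA : ∀ a, eval a A.det = (Matrix.of fun i j => g (L i a) j).det := fun a => by
    rw [RingHom.map_det]
    congr 1
    ext i j
    have : L i a = ∑ q, a q • L i (Pi.single q 1) := by
      conv_lhs => rw [pi_eq_sum_univ' a, map_sum]
      simp
    simp [A, this, mul_comm]
  refine ⟨A.det, ?_, ?_, fun a ha => ?_⟩
  · rw [Matrix.det_apply]
    refine IsWeightedHomogeneous.sum _ _ _ fun τ _ => ?_
    have hprod : IsWeightedHomogeneous w (∏ i, A (τ i) i) (∑ i, wt (τ i)) := by
      refine IsWeightedHomogeneous.prod _ _ _ fun i _ => ?_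
      refine IsWeightedHomogeneous.sum _ _ _ fun q _ => ?_
      by_cases hq : w q = wt (τ i)
      · rw [← hq]
        exact (isWeightedHomogeneous_X k w q).C_mul _
      · simp [hL _ _ hq, isWeightedHomogeneous_zero]
    rw [Equiv.sum_comp τ wt] at hprod
    rcases Int.units_eq_one_or (Equiv.Perm.sign τ) with h | h
    · simpa [h] using hprod
    · simpa [h] using hprod.neg
  · rw [hA]
    have : (Matrix.of fun i j => g (L i a₀) j) = (1 : Matrix ι ι k) := by
      ext i j
      simp [hg', Matrix.one_apply, Pi.single_apply, eq_comm]
    simp [this]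
  · rw [hA] at ha
    have := Matrix.linearIndependent_rows_of_det_ne_zero ha
    exact LinearIndependent.of_comp g this

/-- Polynomials in the coordinates of a family of points of projective space that are homogeneous in
the coordinates of each point. -/
def IsMultihomogeneous {m t : ℕ} (f : MvPolynomial (Fin m × Fin t) k) : Prop :=
  ∃ d : Fin m → ℕ,
    IsWeightedHomogeneous (fun q : Fin m × Fin t => (Pi.single q.1 1 : Fin m → ℕ)) f d

theorem IsMultihomogeneous.mul {m t : ℕ} {f g : MvPolynomial (Fin m × Fin t) k}
    (hf : IsMultihomogeneous f) (hg : IsMultihomogeneous g) : IsMultihomogeneous (f * g) := by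
  obtain ⟨d, hd⟩ := hf
  obtain ⟨d', hd'⟩ := hg
  exact ⟨_, hd.mul hd'⟩

theorem IsMultihomogeneous.prod {m t : ℕ} {ι : Type*} (s : Finset ι)
    {f : ι → MvPolynomial (Fin m × Fin t) k} (hf : ∀ i, IsMultihomogeneous (f i)) :
    IsMultihomogeneous (∏ i ∈ s, f i) := by
  choose d hd using hf
  exact ⟨_, IsWeightedHomogeneous.prod s f d fun i _ => hd i⟩

/-- Rescaling the points of a family multiplies a multihomogeneous polynomial by a scalar. -/
theorem IsMultihomogeneous.eval_smul {m t : ℕ} {f : MvPolynomial (Fin m × Fin t) k}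
    (hf : IsMultihomogeneous f) :
    ∃ d : Fin m → ℕ, ∀ (s : Fin m → k) (a : Fin m → Fin t → k),
      eval (fun q => s q.1 * a q.1 q.2) f = (∏ l, s l ^ d l) * eval (fun q => a q.1 q.2) f := by
  obtain ⟨d, hd⟩ := hf
  refine ⟨d, fun s a => ?_⟩
  rw [eval_eq, eval_eq, Finset.mul_sum]
  refine Finset.sum_congr rfl fun n hn => ?_
  have h := hd (mem_support_iff.1 hn)
  have hdl : ∀ l, d l = ∑ j, n (l, j) := fun l => by
    rw [← h, Finsupp.weight_apply, Finsupp.sum_fintype _ _ (by simp), Finset.sum_apply,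
      Fintype.sum_prod_type, Finset.sum_eq_single l]
    · simp
    · intro b _ hb
      simp [hb.symm]
    · simp
  have hs : ∏ q : Fin m × Fin t, s q.1 ^ n q = ∏ l, s l ^ d l := by
    rw [Fintype.prod_prod_type]
    refine Finset.prod_congr rfl fun l _ => ?_
    rw [hdl, ← Finset.prod_pow_eq_pow_sum]
  have hsub : ∀ g : Fin m × Fin t → k, ∏ q ∈ n.support, g q ^ n q = ∏ q, g q ^ n q := fun g =>
    Finset.prod_subset (Finset.subset_univ _) fun q _ hq => by
      simp [Finsupp.notMem_support_iff.1 hq]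
  rw [hsub, hsub, ← hs]
  simp only [mul_pow, Finset.prod_mul_distrib]
  ring

/-- Over an infinite field a non-zero multihomogeneous polynomial does not vanish identically on
`(ℙ^{t-1}(k))^c`. -/
theorem IsMultihomogeneous.exists_eval_rep_ne_zero [Infinite k] {m t : ℕ} (ht : 0 < t)
    {f : MvPolynomial (Fin m × Fin t) k} (hf : IsMultihomogeneous f) (h0 : f ≠ 0) :
    ∃ x : Fin m → Projectivization k (Fin t → k), eval (fun q => (x q.1).rep q.2) f ≠ 0 := by
  -- The extra factor makes the first coordinate of each point non-zero.
  have h0' : f * ∏ l, X (l, ⟨0, ht⟩) ≠ 0 :=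
    mul_ne_zero h0 (Finset.prod_ne_zero_iff.2 fun l _ => X_ne_zero _)
  obtain ⟨a, ha⟩ : ∃ a, eval a (f * ∏ l, X (l, ⟨0, ht⟩)) ≠ 0 := by
    by_contra! h
    exact h0' (MvPolynomial.funext fun a => by rw [h a, map_zero])
  rw [map_mul, map_prod] at ha
  have ha0 : ∀ l, (fun j => a (l, j)) ≠ 0 := fun l hl => by
    refine right_ne_zero_of_mul ha (Finset.prod_eq_zero (Finset.mem_univ l) ?_)
    simpa using congr_fun hl ⟨0, ht⟩
  choose s hs using fun l => Projectivization.exists_smul_eq_mk_rep k _ (ha0 l)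
  obtain ⟨d, hd⟩ := hf.eval_smul
  refine ⟨fun l => Projectivization.mk k _ (ha0 l), ?_⟩
  have := hd (fun l => (s l : k)) fun l j => a (l, j)
  have he : (fun q : Fin m × Fin t => (Projectivization.mk k _ (ha0 q.1)).rep q.2)
      = fun q => (s q.1 : k) * a (q.1, q.2) := by
    funext q
    rw [← hs q.1]
    rfl
  rw [he, this]
  exact mul_ne_zero (Finset.prod_ne_zero_iff.2 fun l _ => pow_ne_zero _ (s l).ne_zero)
    (left_ne_zero_of_mul ha)

variable {X Y : Type*} [AddCommGroup X] [Module k X] [FiniteDimensional k X] [AddCommGroup Y]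
  [Module k Y] {t : ℕ}

/-- The rank of the family of linear maps `M (a i)`: the dimension of the sum of their images. -/
def familyRank {ι : Type*} (M : (Fin t → k) →ₗ[k] X →ₗ[k] Y) (a : ι → Fin t → k) : ℕ :=
  Module.finrank k (⨆ i, LinearMap.range (M (a i)) : Submodule k Y)

/-- The rank of a family of linear maps is lower semicontinuous in the parameters. -/
theorem exists_familyRank_le {m : ℕ} (M : (Fin t → k) →ₗ[k] X →ₗ[k] Y)
    (a₀ : Fin m → Fin t → k) :
    ∃ f : MvPolynomial (Fin m × Fin t) k, IsMultihomogeneous f ∧ f ≠ 0 ∧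
      ∀ a : Fin m → Fin t → k, eval (fun q => a q.1 q.2) f ≠ 0 →
        familyRank M a₀ ≤ familyRank M a := by
  classical
  have hspan : ∀ a : Fin m → Fin t → k, (⨆ i, LinearMap.range (M (a i)) : Submodule k Y)
      = Submodule.span k {y | ∃ i x, M (a i) x = y} := fun a => by
    apply le_antisymm
    · refine iSup_le fun i => ?_
      rintro _ ⟨x, rfl⟩
      exact Submodule.subset_span ⟨i, x, rfl⟩
    · rw [Submodule.span_le]
      rintro _ ⟨i, x, rfl⟩
      exact Submodule.mem_iSup_of_mem i ⟨x, rfl⟩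
  obtain ⟨b, hb, hbs, hbi⟩ := exists_linearIndependent k {y | ∃ i x, M (a₀ i) x = y}
  have hfin : FiniteDimensional k (Submodule.span k b) := by
    rw [hbs, ← hspan]
    infer_instance
  have : Fintype b := by
    have h := LinearIndependent.finite (R := k) (ι := b)
      (f := fun y => (⟨y, Submodule.subset_span y.2⟩ : Submodule.span k b))
      (LinearIndependent.of_comp (Submodule.span k b).subtype hbi)
    exact Fintype.ofFinite b
  choose i x hix using fun y : b => hb y.2
  let L : b → (Fin m × Fin t → k) →ₗ[k] Y := fun y =>
    (LinearMap.applyₗ (x y)) ∘ₗ M ∘ₗ LinearMap.funLeft k k (fun j => (i y, j))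
  obtain ⟨f, hf, hf0, hfa⟩ := exists_minor
    (fun q : Fin m × Fin t => (Pi.single q.1 1 : Fin m → ℕ)) (fun y => Pi.single (i y) 1) L
    (fun y q hq => by
      have : (fun j => (Pi.single q 1 : Fin m × Fin t → k) (i y, j)) = 0 := by
        funext j
        apply Pi.single_eq_of_ne
        rintro rfl
        exact hq rfl
      change M (fun j => (Pi.single q 1 : Fin m × Fin t → k) (i y, j)) (x y) = 0
      simp [this])
    (fun q => a₀ q.1 q.2) (by
      convert hbi using 2 with y
      exact hix y)
  refine ⟨f, ⟨_, hf⟩, fun h => hf0 (by simp [h]), fun a ha => ?_⟩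
  have hl := hfa _ ha
  have h1 : familyRank M a₀ = Fintype.card b := by
    rw [familyRank, hspan, ← hbs, finrank_span_set_eq_card hbi, Set.toFinset_card]
  rw [h1, ← finrank_span_eq_card hl, familyRank]
  refine Submodule.finrank_mono (Submodule.span_le.2 ?_)
  rintro _ ⟨y, rfl⟩
  exact Submodule.mem_iSup_of_mem (i y) ⟨x y, rfl⟩

/-- The largest rank of a family of `m` of the maps `M a`; it is also the rank of a generic such
family. -/
theorem exists_generic_familyRank (M : (Fin t → k) →ₗ[k] X →ₗ[k] Y) (m : ℕ) :
    ∃ ρ : ℕ, (∀ a : Fin m → Fin t → k, familyRank M a ≤ ρ) ∧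
      ∃ f : MvPolynomial (Fin m × Fin t) k, IsMultihomogeneous f ∧ f ≠ 0 ∧
        ∀ a : Fin m → Fin t → k, eval (fun q => a q.1 q.2) f ≠ 0 → familyRank M a = ρ := by
  have hfin : FiniteDimensional k (⨆ v, LinearMap.range (M v) : Submodule k Y) := by
    have : (⨆ v, LinearMap.range (M v) : Submodule k Y)
        = ⨆ j : Fin t, LinearMap.range (M (Pi.single j 1)) := by
      apply le_antisymm
      · refine iSup_le fun v => ?_
        rintro _ ⟨x, rfl⟩
        rw [pi_eq_sum_univ' v, map_sum, LinearMap.sum_apply]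
        refine Submodule.sum_mem _ fun j _ => ?_
        rw [map_smul, LinearMap.smul_apply]
        exact Submodule.smul_mem _ _ (Submodule.mem_iSup_of_mem j ⟨x, rfl⟩)
      · exact iSup_le fun j => le_iSup (fun v => LinearMap.range (M v)) _
    rw [this]
    infer_instance
  have hbd : BddAbove (Set.range fun a : Fin m → Fin t → k => familyRank M a) := by
    refine ⟨Module.finrank k (⨆ v, LinearMap.range (M v) : Submodule k Y), ?_⟩
    rintro _ ⟨a, rfl⟩
    exact Submodule.finrank_mono (iSup_le fun i => le_iSup (fun v => LinearMap.range (M v)) _)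
  obtain ⟨a₀, ha₀⟩ := Nat.sSup_mem (Set.range_nonempty _) hbd
  have hle : ∀ a : Fin m → Fin t → k, familyRank M a ≤ familyRank M a₀ := fun a => by
    have : familyRank M a₀ = _ := ha₀
    rw [this]
    exact le_csSup hbd ⟨a, rfl⟩
  obtain ⟨f, hf, hf0, hfa⟩ := exists_familyRank_le M a₀
  exact ⟨_, hle, f, hf, hf0, fun a ha => le_antisymm (hle a) (hfa a ha)⟩

end Generic

/-! ### Rank inequalities for linear spaces of linear maps -/

section Rank

variable {k : Type*} [Field k] {X Y : Type*} [AddCommGroup X] [Module k X] [AddCommGroup Y]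
  [Module k Y]

/-- There is a basis of the parameter space all of whose subfamilies have the generic rank. -/
theorem exists_generic_basis [Infinite k] {t : ℕ} (M : (Fin t → k) →ₗ[k] X →ₗ[k] Y) {ρ : ℕ → ℕ}
    (hρ : ∀ m, ∃ f : MvPolynomial (Fin m × Fin t) k, IsMultihomogeneous f ∧ f ≠ 0 ∧
        ∀ a : Fin m → Fin t → k, eval (fun q => a q.1 q.2) f ≠ 0 → familyRank M a = ρ m) :
    ∃ a : Fin t → Fin t → k, LinearIndependent k a ∧ ∀ s : Finset (Fin t),
      Module.finrank k (s.sup fun i => LinearMap.range (M (a i)) : Submodule k Y) = ρ s.card := by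
  choose f _ hf0 hf using hρ
  let j : ∀ s : Finset (Fin t), Fin s.card × Fin t → Fin t × Fin t :=
    fun s => Prod.map (s.orderEmbOfFin rfl) id
  have hj : ∀ s, Function.Injective (j s) := fun s =>
    (s.orderEmbOfFin rfl).injective.prodMap Function.injective_id
  have hne : (Matrix.mvPolynomialX (Fin t) (Fin t) k).det
      * ∏ s : Finset (Fin t), rename (j s) (f s.card) ≠ 0 :=
    mul_ne_zero (Matrix.det_mvPolynomialX_ne_zero _ _) (Finset.prod_ne_zero_iff.2 fun s _ =>
      (map_ne_zero_iff _ (rename_injective _ (hj s))).2 (hf0 _))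
  obtain ⟨a, ha⟩ : ∃ a, eval a ((Matrix.mvPolynomialX (Fin t) (Fin t) k).det
      * ∏ s : Finset (Fin t), rename (j s) (f s.card)) ≠ 0 := by
    by_contra! h
    exact hne (MvPolynomial.funext fun a => by rw [h a, map_zero])
  rw [map_mul, map_prod, mul_ne_zero_iff, Finset.prod_ne_zero_iff] at ha
  refine ⟨fun i l => a (i, l), ?_, fun s => ?_⟩
  · refine Matrix.linearIndependent_rows_of_det_ne_zero (A := Matrix.of fun i l => a (i, l)) ?_
    have := ha.1
    rw [RingHom.map_det] at this
    convert this
    ext i l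
    simp
  · have h1 := ha.2 s (Finset.mem_univ s)
    rw [eval_rename] at h1
    rw [← hf _ (fun i l => a (s.orderEmbOfFin rfl i, l)) h1, familyRank]
    have heq : (s.sup fun i => LinearMap.range (M fun l => a (i, l)))
        = ⨆ i, LinearMap.range (M fun l => a (s.orderEmbOfFin rfl i, l)) := ?_
    · rw [heq]
    rw [Finset.sup_eq_iSup]
    apply le_antisymm
    · refine iSup₂_le fun i hi => ?_
      obtain ⟨i', rfl⟩ : i ∈ Set.range (s.orderEmbOfFin rfl) := by
        rw [Finset.range_orderEmbOfFin]
        exact hi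
      exact le_iSup (fun i => LinearMap.range (M fun l => a (s.orderEmbOfFin rfl i, l))) i'
    · exact iSup_le fun i => le_iSup₂ (f := fun i (_ : i ∈ s) =>
        LinearMap.range (M fun l => a (i, l))) _ (Finset.orderEmbOfFin_mem s rfl i)

variable [FiniteDimensional k X]

theorem finrank_map_add_finrank_inf_ker (A : X →ₗ[k] Y) (L : Submodule k X) :
    Module.finrank k (L.map A) + Module.finrank k (L ⊓ LinearMap.ker A : Submodule k X)
      = Module.finrank k L := by
  have h := (A.domRestrict L).finrank_range_add_finrank_ker
  rw [LinearMap.range_domRestrict, LinearMap.ker_domRestrict] at h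
  rw [← h, ← Submodule.map_comap_subtype, Submodule.finrank_map_subtype_eq]

theorem finrank_sup_submodular (P Q S : Submodule k Y) [FiniteDimensional k P]
    [FiniteDimensional k Q] [FiniteDimensional k S] :
    Module.finrank k (P ⊔ (Q ⊔ S) : Submodule k Y) + Module.finrank k P
      ≤ Module.finrank k (P ⊔ S : Submodule k Y) + Module.finrank k (P ⊔ Q : Submodule k Y) := by
  rw [← Submodule.finrank_sup_add_finrank_inf_eq (P ⊔ S)]
  have h1 : P ⊔ (Q ⊔ S) ≤ (P ⊔ S) ⊔ (P ⊔ Q) := sup_le (le_sup_of_le_left le_sup_left)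
    (sup_le (le_sup_of_le_right le_sup_right) (le_sup_of_le_left le_sup_right))
  have h2 : P ≤ (P ⊔ S) ⊓ (P ⊔ Q) := le_inf le_sup_left le_sup_left
  exact add_le_add (Submodule.finrank_mono h1) (Submodule.finrank_mono h2)

theorem finrank_inf_supermodular (P Q S : Submodule k X) :
    Module.finrank k (P ⊓ S : Submodule k X) + Module.finrank k (P ⊓ Q : Submodule k X)
      ≤ Module.finrank k (P ⊓ (Q ⊓ S) : Submodule k X) + Module.finrank k P := by
  rw [← Submodule.finrank_sup_add_finrank_inf_eq, add_comm]
  have h1 : (P ⊓ S) ⊓ (P ⊓ Q) ≤ P ⊓ (Q ⊓ S) := le_inf (inf_le_of_left_le inf_le_left)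
    (le_inf (inf_le_of_right_le inf_le_right) (inf_le_of_left_le inf_le_right))
  have h2 : (P ⊓ S) ⊔ (P ⊓ Q) ≤ P := sup_le inf_le_left inf_le_left
  exact add_le_add (Submodule.finrank_mono h1) (Submodule.finrank_mono h2)

/-- If no map of the pencil spanned by `A` and `B` has larger rank than `A`, a vector in the image of
every general map of the pencil lies in the image of `A`: otherwise it would remain outside the image
of the general map. -/
theorem mem_range_of_pencil [Infinite k] {A B : X →ₗ[k] Y}
    (h : ∀ α β : k, Module.finrank k (LinearMap.range (α • A + β • B))
      ≤ Module.finrank k (LinearMap.range A)) {w : Y}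
    (hw : ∀ α β : k, α ≠ 0 → β ≠ 0 → w ∈ LinearMap.range (α • A + β • B)) :
    w ∈ LinearMap.range A := by
  by_contra hwA
  let A' : X × k →ₗ[k] Y := A.coprod (LinearMap.toSpanSingleton k Y w)
  let B' : X × k →ₗ[k] Y := B ∘ₗ LinearMap.fst k X k
  let M : (Fin 2 → k) →ₗ[k] (X × k) →ₗ[k] Y :=
    (LinearMap.proj 0).smulRight A' + (LinearMap.proj 1).smulRight B'
  obtain ⟨f, hf, hf0, hfa⟩ := exists_familyRank_le (m := 1) M fun _ => ![1, 0]
  obtain ⟨a, ha⟩ : ∃ a, eval a (f * (MvPolynomial.X (0, 0) * MvPolynomial.X (0, 1))) ≠ 0 := by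
    by_contra! h
    exact mul_ne_zero hf0 (mul_ne_zero (X_ne_zero _) (X_ne_zero _))
      (MvPolynomial.funext fun a => by rw [h a, map_zero])
  simp only [map_mul, eval_X, mul_ne_zero_iff] at ha
  have hle := hfa (fun l j => a (l, j)) ha.1
  rw [familyRank, familyRank, iSup_unique, iSup_unique] at hle
  have h1 : LinearMap.range (M ![1, 0]) = LinearMap.range A ⊔ k ∙ w := by
    have : M ![1, 0] = A' := by simp [M]
    rw [this, LinearMap.range_coprod, LinearMap.range_toSpanSingleton]
  have h2 : LinearMap.range (M fun j => a (default, j))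
      ≤ LinearMap.range (a (0, 0) • A + a (0, 1) • B) := by
    rintro _ ⟨⟨x, s⟩, rfl⟩
    have : M (fun j => a (default, j)) (x, s)
        = (a (0, 0) • A + a (0, 1) • B) x + (a (0, 0) * s) • w := by
      have hd : (default : Fin 1) = 0 := rfl
      simp only [M, A', B', hd, LinearMap.add_apply, LinearMap.smulRight_apply, LinearMap.proj_apply,
        LinearMap.smul_apply, LinearMap.coprod_apply, LinearMap.toSpanSingleton_apply,
        LinearMap.comp_apply, LinearMap.fst_apply, smul_add, mul_smul]
      abel
    rw [this]
    exact add_mem ⟨x, rfl⟩ (Submodule.smul_mem _ _ (hw _ _ ha.2.1 ha.2.2))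
  have h3 : LinearMap.range A < LinearMap.range A ⊔ k ∙ w :=
    lt_of_le_of_ne le_sup_left fun he => hwA (by
      rw [he]
      exact Submodule.mem_sup_right (Submodule.mem_span_singleton_self w))
  have h4 := Submodule.finrank_lt_finrank_of_lt h3
  rw [h1] at hle
  have h5 := Submodule.finrank_mono h2
  have h6 := h (a (0, 0)) (a (0, 1))
  omega

/-- The case of a pencil: if `A` has the largest rank `ρ` among the maps `α A + β B`, then the rank
of the block row `(A B)` and that of the block column with entries `A`, `B` add up to at most `3 ρ`.

For `x ∈ ker A` the vector `B x` lies in the image of `A`, say `B x = A y`, and then so does `B y`,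
as `(α A + β B) (α x - β y) = -β² B y`. So `B` induces a map from the quotient of `X` by
`A⁻¹ (B (ker A))` onto `(im A + im B) / im A`. -/
theorem finrank_range_sup_add_le [Infinite k] {A B : X →ₗ[k] Y}
    (h : ∀ α β : k, Module.finrank k (LinearMap.range (α • A + β • B))
      ≤ Module.finrank k (LinearMap.range A)) :
    Module.finrank k (LinearMap.range A ⊔ LinearMap.range B : Submodule k Y) + Module.finrank k X
      ≤ 3 * Module.finrank k (LinearMap.range A)
        + Module.finrank k (LinearMap.ker A ⊓ LinearMap.ker B : Submodule k X) := by
  set K := LinearMap.ker A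
  set P := K.map B with hP
  set L := P.comap A with hL
  have hPA : P ≤ LinearMap.range A := by
    rintro _ ⟨x, hx, rfl⟩
    refine mem_range_of_pencil h fun α β _ hβ => ⟨β⁻¹ • x, ?_⟩
    have : A x = 0 := hx
    simp [this, hβ]
  have hBL : L.map B ≤ LinearMap.range A := by
    rintro _ ⟨y, ⟨x, hx, hxy⟩, rfl⟩
    have hx0 : A x = 0 := hx
    refine mem_range_of_pencil h fun α β _ hβ => ⟨-(β⁻¹ * β⁻¹) • (α • x - β • y), ?_⟩
    have : (α • A + β • B) (α • x - β • y) = -((β * β) • B y) := by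
      simp only [LinearMap.add_apply, LinearMap.smul_apply, map_sub, map_smul, hx0, hxy, smul_zero,
        mul_smul]
      rw [smul_add β, smul_comm β α (A y), zero_add]
      abel
    rw [map_smul, this, smul_neg, neg_smul, neg_neg, smul_smul]
    have : β⁻¹ * β⁻¹ * (β * β) = 1 := by field_simp
    rw [this, one_smul]
  have hKL : K ≤ L := fun x hx => by
    have : A x = 0 := hx
    simp [hL, this]
  obtain ⟨L', hL'⟩ := Submodule.exists_isCompl L
  have e1 := Submodule.finrank_add_eq_of_isCompl hL'
  have e2 := finrank_map_add_finrank_inf_ker A L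
  rw [hL, Submodule.map_comap_eq, inf_eq_right.2 hPA, ← hL, inf_eq_right.2 hKL] at e2
  have e3 := finrank_map_add_finrank_inf_ker B K
  have e4 := A.finrank_range_add_finrank_ker
  have e5 : Module.finrank k (LinearMap.range A ⊔ LinearMap.range B : Submodule k Y)
      ≤ Module.finrank k (LinearMap.range A) + Module.finrank k L' := by
    have hB : LinearMap.range B = L.map B ⊔ L'.map B := by
      rw [← Submodule.map_sup, hL'.sup_eq_top, Submodule.map_top]
    calc _ ≤ Module.finrank k (LinearMap.range A ⊔ L'.map B : Submodule k Y) :=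
          Submodule.finrank_mono (sup_le le_sup_left (by
            rw [hB]
            exact sup_le (le_sup_of_le_left hBL) le_sup_right))
      _ ≤ _ := (Submodule.finrank_add_le_finrank_add_finrank _ _).trans
          (by gcongr; exact Submodule.finrank_map_le B L')
  change _ + Module.finrank k K = _ at e4
  rw [← hP] at e3
  omega

/-- If `A` has the largest rank `ρ` in each of the pencils spanned by `A` and one of the maps `B i`,
then the ranks of the block row and of the block column formed by `A` and the `B i` add up to at most
`ρ` for each `B i` and `2 ρ` for `A`. -/
theorem finrank_range_sup_finset_add_le [Infinite k] {ι : Type*} {A : X →ₗ[k] Y}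
    {B : ι → X →ₗ[k] Y}
    (h : ∀ i, ∀ α β : k, Module.finrank k (LinearMap.range (α • A + β • B i))
      ≤ Module.finrank k (LinearMap.range A)) (s : Finset ι) :
    Module.finrank k (LinearMap.range A ⊔ s.sup fun i => LinearMap.range (B i) : Submodule k Y)
        + Module.finrank k X
      ≤ (s.card + 2) * Module.finrank k (LinearMap.range A)
        + Module.finrank k (LinearMap.ker A ⊓ s.inf fun i => LinearMap.ker (B i) : Submodule k X) := by
  classical
  have e4 := A.finrank_range_add_finrank_ker
  induction s using Finset.induction_on with
  | empty =>
    rw [Finset.sup_empty, Finset.inf_empty, sup_bot_eq, inf_top_eq, Finset.card_empty]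
    omega
  | insert i s hi ih =>
    rw [Finset.sup_insert, Finset.inf_insert, Finset.card_insert_of_notMem hi]
    have : FiniteDimensional k (s.sup fun i => LinearMap.range (B i) : Submodule k Y) :=
      Submodule.finite_finset_sup _ _
    have e1 := finrank_sup_submodular (LinearMap.range A) (LinearMap.range (B i))
      (s.sup fun i => LinearMap.range (B i))
    have e2 := finrank_inf_supermodular (LinearMap.ker A) (LinearMap.ker (B i))
      (s.inf fun i => LinearMap.ker (B i))
    have e3 := finrank_range_sup_add_le (h i)
    nlinarith

theorem concave_interpolation {ρ : ℕ → ℤ} {t : ℕ}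
    (h : ∀ m, m + 2 ≤ t → ρ (m + 2) + ρ m ≤ 2 * ρ (m + 1)) {c : ℕ} (hc : 1 ≤ c) (hct : c ≤ t) :
    ((t : ℤ) - c) * ρ 1 + ((c : ℤ) - 1) * ρ t ≤ ((t : ℤ) - 1) * ρ c := by
  obtain ⟨d, rfl⟩ : ∃ d, c = d + 1 := ⟨c - 1, by omega⟩
  have anti : ∀ m n, m ≤ n → n + 1 ≤ t → ρ (n + 1) - ρ n ≤ ρ (m + 1) - ρ m := by
    intro m n hmn
    induction n, hmn using Nat.le_induction with
    | base => intro; rfl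
    | succ n hn ih =>
      intro hnt
      have := ih (by omega)
      have := h n hnt
      linarith
  have up : ∀ n, d + 1 ≤ n → n ≤ t →
      ρ n ≤ ρ (d + 1) + ((n : ℤ) - (d + 1)) * (ρ (d + 1) - ρ d) := by
    intro n hn
    induction n, hn using Nat.le_induction with
    | base => intro; simp
    | succ n hn ih =>
      intro hnt
      have := ih (by omega)
      have := anti d n (by omega) hnt
      push_cast
      linarith
  have low : ∀ n, 1 ≤ n → n ≤ d + 1 → ρ 1 + ((n : ℤ) - 1) * (ρ (d + 1) - ρ d) ≤ ρ n := by
    intro n hn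
    induction n, hn using Nat.le_induction with
    | base => intro; simp
    | succ n hn ih =>
      intro hnt
      have := ih (by omega)
      have := anti n d (by omega) hct
      push_cast
      linarith
  have h1 := up t hct le_rfl
  have h2 := low (d + 1) hc le_rfl
  have h3 : (0 : ℤ) ≤ (t : ℤ) - (d + 1) := by
    have : ((d + 1 : ℕ) : ℤ) ≤ t := by exact_mod_cast hct
    push_cast at this
    linarith
  push_cast at h2 ⊢
  nlinarith [mul_le_mul_of_nonneg_left h2 h3,
    mul_le_mul_of_nonneg_left h1 (Int.natCast_nonneg d)]

/-- The bound for the generic rank of families of `c` of the maps `M a`, in terms of the ranks of the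
block row and the block column formed by the images of a basis of the parameter space. -/
theorem generic_familyRank_bound [Infinite k] {t : ℕ} (M : (Fin t → k) →ₗ[k] X →ₗ[k] Y)
    {ρ : ℕ → ℕ} (hle : ∀ m, ∀ a : Fin m → Fin t → k, familyRank M a ≤ ρ m)
    (hρ : ∀ m, ∃ f : MvPolynomial (Fin m × Fin t) k, IsMultihomogeneous f ∧ f ≠ 0 ∧
        ∀ a : Fin m → Fin t → k, eval (fun q => a q.1 q.2) f ≠ 0 → familyRank M a = ρ m)
    {c : ℕ} (hc : 1 ≤ c) (hct : c ≤ t) :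
    ((t : ℤ) - c) * (Module.finrank k X
          - Module.finrank k (⨅ i, LinearMap.ker (M (Pi.single i 1)) : Submodule k X))
        + ((c : ℤ) * t - 1) * familyRank M (fun i : Fin t => Pi.single i 1)
      ≤ ((t : ℤ) ^ 2 - 1) * ρ c := by
  obtain ⟨a, hli, ha⟩ := exists_generic_basis M hρ
  have hfin : ∀ s : Finset (Fin t),
      FiniteDimensional k (s.sup fun i => LinearMap.range (M (a i)) : Submodule k Y) :=
    fun s => Submodule.finite_finset_sup _ _
  have hconc : ∀ m, m + 2 ≤ t → (ρ (m + 2) : ℤ) + ρ m ≤ 2 * ρ (m + 1) := fun m hm => by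
    obtain ⟨u, -, hu⟩ := Finset.exists_subset_card_eq (s := (Finset.univ : Finset (Fin t)))
      (n := m + 2) (by simpa using hm)
    obtain ⟨i, hi, j, hj, hij⟩ := Finset.one_lt_card.1 (by omega : 1 < u.card)
    have hj' : j ∈ u.erase i := Finset.mem_erase.2 ⟨hij.symm, hj⟩
    set s := (u.erase i).erase j with hs
    have hjs : j ∉ s := Finset.notMem_erase j _
    have his : i ∉ s := fun h => Finset.notMem_erase i u (Finset.mem_of_mem_erase h)
    have hus : u = insert i (insert j s) := by
      rw [hs, Finset.insert_erase hj', Finset.insert_erase hi]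
    have hii : i ∉ insert j s := by simp [hij, his]
    have hsc : s.card = m := by
      rw [hus, Finset.card_insert_of_notMem hii, Finset.card_insert_of_notMem hjs] at hu
      omega
    have := hfin s
    have h0 := finrank_sup_submodular (s.sup fun i => LinearMap.range (M (a i)))
      (LinearMap.range (M (a i))) (LinearMap.range (M (a j)))
    have h1 := ha s
    have h2 := ha (insert i s)
    have h3 := ha (insert j s)
    have h4 := ha (insert i (insert j s))
    rw [Finset.card_insert_of_notMem his, Finset.sup_insert, sup_comm] at h2
    rw [Finset.card_insert_of_notMem hjs, Finset.sup_insert, sup_comm] at h3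
    rw [Finset.card_insert_of_notMem hii, Finset.card_insert_of_notMem hjs, Finset.sup_insert,
      Finset.sup_insert, ← sup_assoc, sup_comm] at h4
    rw [h1, h2, h3, h4, hsc] at h0
    have h0' : ρ (m + 2) + ρ m ≤ ρ (m + 1) + ρ (m + 1) := h0
    omega
  have h1 := concave_interpolation (ρ := fun m => (ρ m : ℤ)) hconc hc hct
  have ht : 0 < t := by omega
  let i₀ : Fin t := ⟨0, ht⟩
  have hr1 : Module.finrank k (LinearMap.range (M (a i₀))) = ρ 1 := by
    have := ha {i₀}
    rwa [Finset.sup_singleton, Finset.card_singleton] at this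
  have hle1 : ∀ v, Module.finrank k (LinearMap.range (M v)) ≤ ρ 1 := fun v => by
    have := hle 1 fun _ => v
    rwa [familyRank, iSup_unique] at this
  -- `M (a i₀)` has the largest rank among all the maps `M v`, hence in each pencil through it.
  have h2 := finrank_range_sup_finset_add_le (A := M (a i₀)) (B := fun i => M (a i))
    (fun i α β => by
      rw [hr1, ← map_smul, ← map_smul, ← map_add]
      exact hle1 _) (Finset.univ.erase i₀)
  have hins := Finset.insert_erase (Finset.mem_univ i₀)
  rw [Finset.card_erase_of_mem (Finset.mem_univ i₀), Finset.card_univ, Fintype.card_fin, hr1] at h2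
  have h3 := Finset.sup_insert (s := Finset.univ.erase i₀) (b := i₀)
    (f := fun i => LinearMap.range (M (a i)))
  have h4 := Finset.inf_insert (s := Finset.univ.erase i₀) (b := i₀)
    (f := fun i => LinearMap.ker (M (a i)))
  rw [hins] at h3 h4
  rw [← h3, ← h4, ha, Finset.card_univ, Fintype.card_fin] at h2
  have h5 : (Finset.univ.inf fun i => LinearMap.ker (M (a i)))
      ≤ ⨅ i, LinearMap.ker (M (Pi.single i 1)) := by
    intro x hx
    rw [Finset.inf_eq_iInf] at hx
    simp only [Finset.mem_univ, iInf_pos, Submodule.mem_iInf, LinearMap.mem_ker] at hx ⊢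
    have hker : Submodule.span k (Set.range a) ≤ LinearMap.ker (M.flip x) := by
      rw [Submodule.span_le]
      rintro _ ⟨i, rfl⟩
      exact hx i
    have : Nonempty (Fin t) := ⟨i₀⟩
    rw [hli.span_eq_top_of_card_eq_finrank (by simp)] at hker
    exact fun i => hker Submodule.mem_top
  have h6 := Submodule.finrank_mono h5
  have h7 := hle t fun i : Fin t => Pi.single i 1
  obtain ⟨n, rfl⟩ : ∃ n, t = n + 1 := ⟨t - 1, by omega⟩
  rw [Nat.add_sub_cancel] at h2
  -- With `a = ρ t` and `b` the rank of the block column, `a + b ≤ (t + 1) * ρ 1`.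
  have h8 : (ρ (n + 1) : ℤ) + (Module.finrank k X
      - Module.finrank k (⨅ i, LinearMap.ker (M (Pi.single i 1)) : Submodule k X))
      ≤ (n + 2) * ρ 1 := by
    zify at h2 h6
    linarith
  have h9 : (0 : ℤ) ≤ ((n + 1 : ℕ) : ℤ) - c := by
    have : (c : ℤ) ≤ (n + 1 : ℕ) := by exact_mod_cast hct
    linarith
  have h10 : (0 : ℤ) ≤ (c : ℤ) * (n + 1 : ℕ) - 1 := by
    have : (1 : ℤ) ≤ c := by exact_mod_cast hc
    push_cast
    nlinarith
  have h11 : (familyRank M (fun i : Fin (n + 1) => Pi.single i 1) : ℤ) ≤ ρ (n + 1) := by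
    exact_mod_cast h7
  have h12 := mul_le_mul_of_nonneg_left h8 h9
  have h13 := mul_le_mul_of_nonneg_left h11 h10
  have h14 := mul_le_mul_of_nonneg_left h1 (by positivity : (0 : ℤ) ≤ (n : ℤ) + 2)
  push_cast at h12 h13 h14 ⊢
  linarith

end Rank

/-! ### Coefficients of derivatives of forms -/

section Derivatives

variable {k : Type*} [Field k] {r : ℕ}

theorem monomialOp_single (κ : DualityAction) (j : Fin r) :
    monomialOp (k := k) κ (Finsupp.single j 1) = op κ j := by
  rw [monomialOp, List.prod_map_eq_pow_single j _ (fun i hi _ => by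
    rw [Finsupp.single_eq_of_ne hi, pow_zero]),
    List.count_eq_one_of_mem (List.nodup_finRange r) (List.mem_finRange j)]
  simp

theorem act_monomial (κ : DualityAction) (n : Fin r →₀ ℕ) (a : k) :
    act κ (monomial n a) = a • monomialOp κ n :=
  AddMonoidAlgebra.lift_single _ _ _

theorem act_X (κ : DualityAction) (j : Fin r) : act (k := k) κ (X j) = op κ j := by
  rw [X, act_monomial, one_smul, monomialOp_single]

theorem act_comm (κ : DualityAction) (p q G : MvPolynomial (Fin r) k) :
    act κ p (act κ q G) = act κ q (act κ p G) := by
  rw [← Module.End.mul_apply, ← map_mul, mul_comm, map_mul, Module.End.mul_apply]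

/-- The coefficients of the derivative of `Q` given by `n` are those of `Q`, shifted by `n` and
multiplied by constants that do not vanish when the characteristic is as required. -/
theorem exists_coeff_monomialOp {e : ℕ} {κ : DualityAction}
    (hκ : κ = DualityAction.differentiation → ringChar k = 0 ∨ e < ringChar k)
    (n m : Fin r →₀ ℕ) :
    ∃ w : k, ((m + n).degree ≤ e → w ≠ 0) ∧
      ∀ Q, coeff m (monomialOp κ n Q) = w * coeff (m + n) Q := by
  have hadd : ∀ n₁ n₂ : Fin r →₀ ℕ,
      (∀ m, ∃ w : k, ((m + n₁).degree ≤ e → w ≠ 0) ∧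
        ∀ Q, coeff m (monomialOp κ n₁ Q) = w * coeff (m + n₁) Q) →
      (∀ m, ∃ w : k, ((m + n₂).degree ≤ e → w ≠ 0) ∧
        ∀ Q, coeff m (monomialOp κ n₂ Q) = w * coeff (m + n₂) Q) →
      ∀ m, ∃ w : k, ((m + (n₁ + n₂)).degree ≤ e → w ≠ 0) ∧
        ∀ Q, coeff m (monomialOp κ (n₁ + n₂) Q) = w * coeff (m + (n₁ + n₂)) Q := by
    intro n₁ n₂ h₁ h₂ m
    obtain ⟨w₁, hw₁, hQ₁⟩ := h₁ m
    obtain ⟨w₂, hw₂, hQ₂⟩ := h₂ (m + n₁)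
    refine ⟨w₁ * w₂, fun h => ?_, fun Q => ?_⟩
    · simp only [map_add] at h hw₁ hw₂
      exact mul_ne_zero (hw₁ (by omega)) (hw₂ (by omega))
    · rw [monomialOp_add, Module.End.mul_apply, hQ₁, hQ₂, mul_assoc, add_assoc]
  have hzero : ∀ m : Fin r →₀ ℕ, ∃ w : k, ((m + 0).degree ≤ e → w ≠ 0) ∧
      ∀ Q, coeff m (monomialOp κ 0 Q) = w * coeff (m + 0) Q := fun m =>
    ⟨1, fun _ => one_ne_zero, fun Q => by simp [monomialOp_zero]⟩
  induction n using Finsupp.induction_linear generalizing m with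
  | zero => exact hzero m
  | add n₁ n₂ h₁ h₂ => exact hadd n₁ n₂ h₁ h₂ m
  | single j b =>
    induction b generalizing m with
    | zero => simpa using hzero m
    | succ b ih =>
      rw [Finsupp.single_add]
      refine hadd _ _ ih (fun m => ?_) m
      rw [monomialOp_single]
      cases κ with
      | differentiation =>
        refine ⟨(m j : k) + 1, fun h => ?_, fun Q => ?_⟩
        · have hle : m j + 1 ≤ e := by
            have := Finsupp.le_degree j (m + Finsupp.single j 1)
            simp only [Finsupp.add_apply, Finsupp.single_eq_same] at this
            omega
          intro h0
          have h1 : ((m j + 1 : ℕ) : k) = 0 := by exact_mod_cast h0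
          rw [ringChar.spec] at h1
          rcases hκ rfl with h | h
          · rw [h, zero_dvd_iff] at h1
            omega
          · have := Nat.le_of_dvd (Nat.succ_pos _) h1
            omega
        · change coeff m (pderiv j Q) = _
          rw [coeff_pderiv, mul_comm]
      | contraction =>
        refine ⟨1, fun _ => one_ne_zero, fun Q => ?_⟩
        change coeff m (Q.divMonomial _) = _
        rw [coeff_divMonomial, add_comm, one_mul]

theorem exists_coeff_act_ne_zero {κ : DualityAction} {p Q : MvPolynomial (Fin r) k}
    {m : Fin r →₀ ℕ} (h : coeff m (act κ p Q) ≠ 0) :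
    ∃ n, coeff n p ≠ 0 ∧ coeff (m + n) Q ≠ 0 := by
  rw [act_apply, coeff_sum] at h
  obtain ⟨n, hn, hne⟩ := Finset.exists_ne_zero_of_sum_ne_zero h
  obtain ⟨w, -, hw⟩ := exists_coeff_monomialOp (k := k) (e := 0) (κ := κ)
    (fun _ => Nat.eq_zero_or_pos _) n m
  rw [coeff_smul, hw, smul_eq_mul] at hne
  exact ⟨n, mem_support_iff.1 hn, right_ne_zero_of_mul (right_ne_zero_of_mul hne)⟩

theorem degree_add_of_coeff_act_ne_zero {κ : DualityAction} {u d : ℕ}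
    {p Q : MvPolynomial (Fin r) k} (hp : p.IsHomogeneous u) (hQ : Q.IsHomogeneous d)
    {m : Fin r →₀ ℕ} (h : coeff m (act κ p Q) ≠ 0) : m.degree + u = d := by
  obtain ⟨n, hn, hmn⟩ := exists_coeff_act_ne_zero h
  have h1 : n.degree = u := by
    by_contra h
    exact hn (hp.coeff_eq_zero h)
  have h2 : (m + n).degree = d := by
    by_contra h
    exact hmn (hQ.coeff_eq_zero h)
  rw [← h1, ← h2, map_add]

theorem isHomogeneous_act {κ : DualityAction} {u d : ℕ} {p Q : MvPolynomial (Fin r) k}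
    (hp : p.IsHomogeneous u) (hQ : Q.IsHomogeneous d) : (act κ p Q).IsHomogeneous (d - u) := by
  rw [← mem_homogeneousSubmodule, homogeneousSubmodule_eq_finsupp_supported]
  intro m hm
  have := degree_add_of_coeff_act_ne_zero hp hQ (mem_support_iff.1 hm)
  change m.degree = d - u
  omega

theorem act_eq_zero_of_lt {κ : DualityAction} {u d : ℕ} {p Q : MvPolynomial (Fin r) k}
    (hp : p.IsHomogeneous u) (hQ : Q.IsHomogeneous d) (h : d < u) : act κ p Q = 0 := by
  ext m
  by_contra hm
  have := degree_add_of_coeff_act_ne_zero hp hQ hm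
  omega

/-- A form of degree at most `e` is determined by its constant derivatives. -/
theorem eq_zero_of_coeff_act_eq_zero {e u : ℕ} {κ : DualityAction}
    (hκ : κ = DualityAction.differentiation → ringChar k = 0 ∨ e < ringChar k) (hu : u ≤ e)
    {Q : MvPolynomial (Fin r) k} (hQ : Q.IsHomogeneous u)
    (h : ∀ q : MvPolynomial (Fin r) k, q.IsHomogeneous u → coeff 0 (act κ q Q) = 0) : Q = 0 := by
  ext m
  by_contra hm
  have hmu : m.degree = u := by
    by_contra h
    exact hm (hQ.coeff_eq_zero h)
  obtain ⟨w, hw, hwQ⟩ := exists_coeff_monomialOp hκ m 0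
  have h0 := h (monomial m 1) (isHomogeneous_monomial 1 hmu)
  rw [act_monomial, one_smul, hwQ, zero_add] at h0
  rw [zero_add] at hw
  exact mul_ne_zero (hw (by omega)) hm h0

/-- A form of positive degree at most `e` whose first derivatives all vanish is zero. -/
theorem eq_zero_of_op_eq_zero {e d : ℕ} {κ : DualityAction}
    (hκ : κ = DualityAction.differentiation → ringChar k = 0 ∨ e < ringChar k) (hd : 0 < d)
    (hde : d ≤ e) {Q : MvPolynomial (Fin r) k} (hQ : Q.IsHomogeneous d)
    (h : ∀ j, op κ j Q = 0) : Q = 0 := by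
  ext m
  by_contra hm
  have hmd : m.degree = d := by
    by_contra h
    exact hm (hQ.coeff_eq_zero h)
  have hm0 : m ≠ 0 := by
    rintro rfl
    simp at hmd
    omega
  obtain ⟨j, hj⟩ := Finsupp.ne_iff.1 hm0
  obtain ⟨m', rfl⟩ : ∃ m', m = m' + Finsupp.single j 1 := by
    refine ⟨m - Finsupp.single j 1, (tsub_add_cancel_of_le ?_).symm⟩
    rw [Finsupp.single_le_iff]
    exact Nat.one_le_iff_ne_zero.2 hj
  obtain ⟨w, hw, hwQ⟩ := exists_coeff_monomialOp hκ (Finsupp.single j 1) m'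
  have h0 := hwQ Q
  rw [monomialOp_single, h j, coeff_zero] at h0
  exact mul_ne_zero (hw (by omega)) hm h0.symm

instance finiteDimensional_homogeneousSubmodule (u : ℕ) :
    FiniteDimensional k (homogeneousSubmodule (Fin r) k u) :=
  Module.Finite.iff_fg.2 (homogeneousSubmodule_fg _ _ u)

/-- The pairing `⟨Q, p⟩ = (p ∘ Q)(0)` between `S` and the forms of degree `u` in `R`. -/
def pairing (κ : DualityAction) (u : ℕ) :
    MvPolynomial (Fin r) k →ₗ[k] Module.Dual k (homogeneousSubmodule (Fin r) k u) :=
  LinearMap.mk₂ k (fun Q p => coeff 0 (act κ p.1 Q)) (by simp) (by simp) (by simp) (by simp)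

theorem pairing_domRestrict_injective {e u : ℕ} {κ : DualityAction}
    (hκ : κ = DualityAction.differentiation → ringChar k = 0 ∨ e < ringChar k) (hu : u ≤ e)
    {T : Submodule k (MvPolynomial (Fin r) k)} (hT : T ≤ homogeneousSubmodule (Fin r) k u) :
    Function.Injective ((pairing κ u).domRestrict T) := by
  rw [← LinearMap.ker_eq_bot, LinearMap.ker_eq_bot']
  rintro ⟨Q, hQ⟩ h
  refine Subtype.ext (eq_zero_of_coeff_act_eq_zero hκ hu (hT hQ) fun q hq => ?_)
  exact LinearMap.congr_fun h ⟨q, hq⟩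

/-! ### Spaces of derivatives and annihilators -/

/-- The forms of degree `i` in `R` acting on the form `∑ a_j F_j`, linearly in both arguments. -/
def derivMap {t : ℕ} (κ : DualityAction) (F : Fin t → MvPolynomial (Fin r) k) (i : ℕ) :
    (Fin t → k) →ₗ[k] homogeneousSubmodule (Fin r) k i →ₗ[k] MvPolynomial (Fin r) k :=
  LinearMap.mk₂ k (fun a p => act κ p.1 (∑ j, a j • F j))
    (by simp [add_smul, Finset.sum_add_distrib]) (by simp [mul_smul, Finset.smul_sum])
    (fun a p q => by rw [Submodule.coe_add, map_add, LinearMap.add_apply])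
    (fun c a p => by rw [Submodule.coe_smul, map_smul, LinearMap.smul_apply])

theorem derivMap_apply {t : ℕ} (κ : DualityAction) (F : Fin t → MvPolynomial (Fin r) k) (i : ℕ)
    (a : Fin t → k) (p : homogeneousSubmodule (Fin r) k i) :
    derivMap κ F i a p = act κ p.1 (∑ j, a j • F j) := rfl

theorem derivMap_single {t : ℕ} (κ : DualityAction) (F : Fin t → MvPolynomial (Fin r) k) (i : ℕ)
    (l : Fin t) (p : homogeneousSubmodule (Fin r) k i) :
    derivMap κ F i (Pi.single l 1) p = act κ p.1 (F l) := by
  rw [derivMap_apply]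
  congr 1
  simp [Pi.single_apply]

theorem mem_iInf_ker_derivMap {t : ℕ} (κ : DualityAction) (F : Fin t → MvPolynomial (Fin r) k)
    (i : ℕ) (p : homogeneousSubmodule (Fin r) k i) :
    p ∈ ⨅ l, LinearMap.ker (derivMap κ F i (Pi.single l 1)) ↔ ∀ l, act κ p.1 (F l) = 0 := by
  simp [derivMap_single]

theorem act_mem_derivSpace (κ : DualityAction) {V : Submodule k (MvPolynomial (Fin r) k)} {i : ℕ}
    {p G : MvPolynomial (Fin r) k} (hp : p.IsHomogeneous i) (hG : G ∈ V) :
    act κ p G ∈ derivSpace κ V i := by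
  rw [act_apply]
  refine Submodule.sum_mem _ fun n hn => Submodule.smul_mem _ _
    (Submodule.subset_span ⟨n, ?_, G, hG, rfl⟩)
  by_contra h
  exact mem_support_iff.1 hn (hp.coeff_eq_zero h)

theorem derivSpace_span {t : ℕ} (κ : DualityAction) (F : Fin t → MvPolynomial (Fin r) k) {c : ℕ}
    (a : Fin c → Fin t → k) (i : ℕ) :
    derivSpace κ (Submodule.span k (Set.range fun l => ∑ j, a l j • F j)) i
      = ⨆ l, LinearMap.range (derivMap κ F i (a l)) := by
  apply le_antisymm
  · rw [derivSpace, Submodule.span_le]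
    rintro _ ⟨n, hn, G, hG, rfl⟩
    change G ∈ (⨆ l, LinearMap.range (derivMap κ F i (a l))).comap (monomialOp κ n)
    refine Submodule.span_le.2 ?_ hG
    rintro _ ⟨l, rfl⟩
    refine Submodule.mem_iSup_of_mem l ⟨⟨monomial n 1, isHomogeneous_monomial 1 hn⟩, ?_⟩
    rw [derivMap_apply, act_monomial, one_smul]
  · refine iSup_le fun l => ?_
    rintro _ ⟨p, rfl⟩
    exact act_mem_derivSpace κ p.2 (Submodule.subset_span ⟨l, rfl⟩)

theorem familyRank_derivMap {t : ℕ} (κ : DualityAction) (F : Fin t → MvPolynomial (Fin r) k)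
    {c : ℕ} (a : Fin c → Fin t → k) (e u : ℕ) :
    familyRank (derivMap κ F (e - u)) a
      = derivDim κ e (Submodule.span k (Set.range fun l => ∑ j, a l j • F j)) u := by
  rw [derivDim, derivSpace_span, familyRank]

theorem familyRank_derivMap_single {t : ℕ} (κ : DualityAction)
    (F : Fin t → MvPolynomial (Fin r) k) (e u : ℕ) :
    familyRank (derivMap κ F (e - u)) (fun i : Fin t => Pi.single i 1)
      = derivDim κ e (Submodule.span k (Set.range F)) u := by
  rw [familyRank_derivMap]
  congr 3
  funext l
  simp [Pi.single_apply]

theorem derivSpace_zero (κ : DualityAction) (V : Submodule k (MvPolynomial (Fin r) k)) :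
    derivSpace κ V 0 = V := by
  apply le_antisymm
  · rw [derivSpace, Submodule.span_le]
    rintro _ ⟨n, hn, G, hG, rfl⟩
    rw [Finsupp.degree_eq_zero_iff] at hn
    rwa [hn, monomialOp_zero]
  · intro G hG
    exact Submodule.subset_span ⟨0, by simp, G, hG, by simp [monomialOp_zero]⟩

theorem derivDim_self (κ : DualityAction) (e : ℕ) (V : Submodule k (MvPolynomial (Fin r) k)) :
    derivDim κ e V e = Module.finrank k V := by
  rw [derivDim, Nat.sub_self, derivSpace_zero]

theorem mem_Ann_inverseModule {s : ℕ} (κ : DualityAction) (G : Fin s → MvPolynomial (Fin r) k)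
    (p : MvPolynomial (Fin r) k) :
    p ∈ Ann κ (inverseModule κ G) ↔ ∀ j, act κ p (G j) = 0 := by
  constructor
  · intro h j
    exact h _ (Submodule.subset_span ⟨1, j, by simp⟩)
  · intro h Q hQ
    change Q ∈ LinearMap.ker (act κ p)
    refine Submodule.span_le.2 ?_ hQ
    rintro _ ⟨q, j, rfl⟩
    change act κ p (act κ q (G j)) = 0
    rw [act_comm, h j, map_zero]

/-- Macaulay duality in degree `u`: the derivatives of order `e - u` of the forms in the span of `F`
are the orthogonal space of the forms of degree `u` annihilating `F`. -/
theorem derivDim_add_finrank_ker {t e u : ℕ} {κ : DualityAction}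
    (hκ : κ = DualityAction.differentiation → ringChar k = 0 ∨ e < ringChar k) (hu : u ≤ e)
    {F : Fin t → MvPolynomial (Fin r) k} (hF : ∀ j, (F j).IsHomogeneous e) :
    derivDim κ e (Submodule.span k (Set.range F)) u
        + Module.finrank k (⨅ l, LinearMap.ker (derivMap κ F u (Pi.single l 1)) :
          Submodule k (homogeneousSubmodule (Fin r) k u))
      = Module.finrank k (homogeneousSubmodule (Fin r) k u) := by
  set V := Submodule.span k (Set.range F)
  have hV : V ≤ homogeneousSubmodule (Fin r) k e := Submodule.span_le.2 (by
    rintro _ ⟨j, rfl⟩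
    exact hF j)
  have hT : derivSpace κ V (e - u) ≤ homogeneousSubmodule (Fin r) k u := by
    rw [derivSpace, Submodule.span_le]
    rintro _ ⟨n, hn, G, hG, rfl⟩
    have := isHomogeneous_act (κ := κ) (isHomogeneous_monomial (1 : k) hn) (hV hG)
    rwa [act_monomial, one_smul, Nat.sub_sub_self hu] at this
  have h1 := LinearMap.finrank_range_of_inj (pairing_domRestrict_injective hκ hu hT)
  rw [derivDim, ← h1, ← Subspace.finrank_add_finrank_dualCoannihilator_eq
    (LinearMap.range ((pairing κ u).domRestrict (derivSpace κ V (e - u))))]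
  have : (⨅ l, LinearMap.ker (derivMap κ F u (Pi.single l 1)) :
      Submodule k (homogeneousSubmodule (Fin r) k u))
      = (LinearMap.range ((pairing κ u).domRestrict
        (derivSpace κ V (e - u)))).dualCoannihilator := by
    ext p
    rw [mem_iInf_ker_derivMap, Submodule.mem_dualCoannihilator]
    constructor
    · rintro h _ ⟨⟨Q, hQ⟩, rfl⟩
      change coeff 0 (act κ p.1 Q) = 0
      have hpV : V ≤ LinearMap.ker (act κ p.1) := Submodule.span_le.2 (by
        rintro _ ⟨j, rfl⟩
        exact h j)
      have hQ0 : derivSpace κ V (e - u) ≤ LinearMap.ker (act κ p.1) := by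
        rw [derivSpace, Submodule.span_le]
        rintro _ ⟨n, -, G, hG, rfl⟩
        have hG0 : act κ p.1 G = 0 := hpV hG
        have := act_comm κ p.1 (monomial n 1) G
        rw [hG0, map_zero, act_monomial, one_smul] at this
        exact this
      have : act κ p.1 Q = 0 := hQ0 hQ
      rw [this, coeff_zero]
    · intro h l
      refine eq_zero_of_coeff_act_eq_zero hκ (Nat.sub_le e u) (isHomogeneous_act p.2 (hF l))
        fun q hq => ?_
      rw [act_comm]
      exact h _ ⟨⟨act κ q (F l), act_mem_derivSpace κ hq (Submodule.subset_span ⟨l, rfl⟩)⟩, rfl⟩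
  rw [this]

end Derivatives

attribute [local instance] MvPolynomial.gradedAlgebra

/-! ### Homogeneous ideals and their socles -/

section Socle

variable {k : Type*} [Field k] {r : ℕ}

theorem isHomogeneous_iff_homogeneousComponent_mem {I : Ideal (MvPolynomial (Fin r) k)} :
    I.IsHomogeneous (homogeneousSubmodule (Fin r) k)
      ↔ ∀ p ∈ I, ∀ u, homogeneousComponent u p ∈ I :=
  ⟨fun h p hp u => by
    have := h u hp
    rwa [DirectSum.decompose, ← decomposition.decompose'_apply] at *, fun h u p hp => by
    have := h p hp u
    rwa [← decomposition.decompose'_apply] at this⟩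

theorem mem_of_homogeneousComponent_mem {I : Ideal (MvPolynomial (Fin r) k)}
    {p : MvPolynomial (Fin r) k} (h : ∀ u, homogeneousComponent u p ∈ I) : p ∈ I := by
  rw [← sum_homogeneousComponent p]
  exact Ideal.sum_mem _ fun u _ => h u

/-- Homogeneous ideals with the same forms are equal. -/
theorem ideal_eq_of_forms {I J : Ideal (MvPolynomial (Fin r) k)}
    (hI : I.IsHomogeneous (homogeneousSubmodule (Fin r) k))
    (hJ : J.IsHomogeneous (homogeneousSubmodule (Fin r) k))
    (h : ∀ u, ∀ p : MvPolynomial (Fin r) k, p.IsHomogeneous u → (p ∈ I ↔ p ∈ J)) : I = J := by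
  rw [isHomogeneous_iff_homogeneousComponent_mem] at hI hJ
  ext p
  exact ⟨fun hp => mem_of_homogeneousComponent_mem fun u =>
      (h u _ (homogeneousComponent_isHomogeneous u p)).1 (hI p hp u),
    fun hp => mem_of_homogeneousComponent_mem fun u =>
      (h u _ (homogeneousComponent_isHomogeneous u p)).2 (hJ p hp u)⟩

theorem mem_gradedPiece {I : Ideal (MvPolynomial (Fin r) k)} {u : ℕ}
    {a : MvPolynomial (Fin r) k ⧸ I} :
    a ∈ gradedPiece I u ↔ ∃ p : MvPolynomial (Fin r) k, p.IsHomogeneous u ∧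
      Ideal.Quotient.mk I p = a := Iff.rfl

instance finiteDimensional_gradedPiece (I : Ideal (MvPolynomial (Fin r) k)) (u : ℕ) :
    FiniteDimensional k (gradedPiece I u) := by
  unfold gradedPiece
  infer_instance

theorem hVector_eq_zero_iff {I : Ideal (MvPolynomial (Fin r) k)} {u : ℕ} :
    hVector I u = 0 ↔ ∀ p : MvPolynomial (Fin r) k, p.IsHomogeneous u → p ∈ I := by
  rw [hVector, Submodule.finrank_eq_zero, Submodule.eq_bot_iff]
  constructor
  · intro h p hp
    exact Ideal.Quotient.eq_zero_iff_mem.1 (h _ (mem_gradedPiece.2 ⟨p, hp, rfl⟩))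
  · rintro h a ha
    obtain ⟨p, hp, rfl⟩ := mem_gradedPiece.1 ha
    exact Ideal.Quotient.eq_zero_iff_mem.2 (h p hp)

/-- The forms of degree `u` in an ideal. -/
def formsIn (I : Ideal (MvPolynomial (Fin r) k)) (u : ℕ) :
    Submodule k (homogeneousSubmodule (Fin r) k u) :=
  (I.restrictScalars k).comap (homogeneousSubmodule (Fin r) k u).subtype

theorem mem_formsIn {I : Ideal (MvPolynomial (Fin r) k)} {u : ℕ}
    {p : homogeneousSubmodule (Fin r) k u} : p ∈ formsIn I u ↔ p.1 ∈ I := Iff.rfl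

theorem hVector_add_finrank_formsIn (I : Ideal (MvPolynomial (Fin r) k)) (u : ℕ) :
    hVector I u + Module.finrank k (formsIn I u)
      = Module.finrank k (homogeneousSubmodule (Fin r) k u) := by
  have h := ((Ideal.Quotient.mkₐ k I).toLinearMap.domRestrict
    (homogeneousSubmodule (Fin r) k u)).finrank_range_add_finrank_ker
  rw [LinearMap.range_domRestrict] at h
  have hker : LinearMap.ker ((Ideal.Quotient.mkₐ k I).toLinearMap.domRestrict
      (homogeneousSubmodule (Fin r) k u)) = formsIn I u := by
    ext p
    exact Ideal.Quotient.eq_zero_iff_mem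
  rwa [hker] at h

theorem mk_mem_socle {I : Ideal (MvPolynomial (Fin r) k)} {p : MvPolynomial (Fin r) k} :
    Ideal.Quotient.mk I p ∈ socle I ↔ ∀ j, p * X j ∈ I := by
  rw [socle, maxHomogeneousIdeal, Ideal.span, Submodule.mem_annihilator_span]
  constructor
  · intro h j
    have := h ⟨_, j, rfl⟩
    rw [smul_eq_mul, ← map_mul] at this
    exact Ideal.Quotient.eq_zero_iff_mem.1 this
  · rintro h ⟨_, j, rfl⟩
    rw [smul_eq_mul, ← map_mul]
    exact Ideal.Quotient.eq_zero_iff_mem.2 (h j)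

theorem socleVector_eq_zero_iff {I : Ideal (MvPolynomial (Fin r) k)} {u : ℕ} :
    socleVector I u = 0 ↔ ∀ p : MvPolynomial (Fin r) k, p.IsHomogeneous u →
      (∀ j, p * X j ∈ I) → p ∈ I := by
  have : FiniteDimensional k ((socle I).restrictScalars k ⊓ gradedPiece I u : Submodule k _) :=
    Submodule.finiteDimensional_inf_right _ _
  rw [socleVector, Submodule.finrank_eq_zero, Submodule.eq_bot_iff]
  constructor
  · intro h p hp hX
    exact Ideal.Quotient.eq_zero_iff_mem.1
      (h _ ⟨mk_mem_socle.2 hX, mem_gradedPiece.2 ⟨p, hp, rfl⟩⟩)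
  · rintro h a ⟨ha, hau⟩
    obtain ⟨p, hp, rfl⟩ := mem_gradedPiece.1 hau
    exact Ideal.Quotient.eq_zero_iff_mem.2 (h p hp (mk_mem_socle.1 ha))

theorem socleVector_eq_hVector {I : Ideal (MvPolynomial (Fin r) k)} {e : ℕ}
    (h : hVector I (e + 1) = 0) : socleVector I e = hVector I e := by
  have : (socle I).restrictScalars k ⊓ gradedPiece I e = gradedPiece I e := by
    rw [inf_eq_right]
    intro a ha
    obtain ⟨p, hp, rfl⟩ := mem_gradedPiece.1 ha
    exact mk_mem_socle.2 fun j => hVector_eq_zero_iff.1 h _ (hp.mul (isHomogeneous_X k j))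
  rw [socleVector, this, hVector]

theorem IsLevel.hVector_top {I : Ideal (MvPolynomial (Fin r) k)} {e t : ℕ} (h : IsLevel I e t) :
    hVector I e = t := by
  rw [← socleVector_eq_hVector (h.above _ (Nat.lt_succ_self e)), h.socle_top]

/-- In a level algebra of socle degree `e`, a form is zero as soon as its multiples of degree `e`
are. -/
theorem IsLevel.mem_of_mul_mem {I : Ideal (MvPolynomial (Fin r) k)} {e t : ℕ} (h : IsLevel I e t)
    {i u : ℕ} (hiu : u + i = e) {p : MvPolynomial (Fin r) k} (hp : p.IsHomogeneous u)
    (hq : ∀ q : MvPolynomial (Fin r) k, q.IsHomogeneous i → q * p ∈ I) : p ∈ I := by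
  induction i generalizing u p with
  | zero => simpa using hq 1 (isHomogeneous_one _ _)
  | succ i ih =>
    refine socleVector_eq_zero_iff.1 (h.socle_other u (by omega)) p hp fun j => ?_
    refine ih (u := u + 1) (by omega) (hp.mul (isHomogeneous_X k j)) fun q hq' => ?_
    have := hq (q * X j) (hq'.mul (isHomogeneous_X k j))
    rwa [mul_assoc, mul_comm (X j) p] at this

theorem isArtinianRing_of_hVector {I : Ideal (MvPolynomial (Fin r) k)} {e : ℕ}
    (h : ∀ u, e < u → hVector I u = 0) : IsArtinianRing (MvPolynomial (Fin r) k ⧸ I) := by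
  have htop : (⨆ u : Fin (e + 1), gradedPiece I u) = ⊤ := by
    rw [eq_top_iff]
    rintro a -
    obtain ⟨p, rfl⟩ := Ideal.Quotient.mk_surjective a
    rw [← sum_homogeneousComponent p, map_sum]
    refine Submodule.sum_mem _ fun u _ => ?_
    by_cases hu : e < u
    · rw [Ideal.Quotient.eq_zero_iff_mem.2 (hVector_eq_zero_iff.1 (h u hu) _
        (homogeneousComponent_isHomogeneous u p))]
      exact zero_mem _
    · exact Submodule.mem_iSup_of_mem (⟨u, by omega⟩ : Fin (e + 1))
        (mem_gradedPiece.2 ⟨_, homogeneousComponent_isHomogeneous u p, rfl⟩)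
  have hfin : FiniteDimensional k (⨆ u : Fin (e + 1), gradedPiece I u : Submodule k _) :=
    inferInstance
  rw [htop] at hfin
  have : FiniteDimensional k (MvPolynomial (Fin r) k ⧸ I) :=
    Module.finite_def.2 (Module.Finite.iff_fg.1 hfin)
  exact isArtinian_of_tower k inferInstance

end Socle

/-! ### Macaulay's correspondence for level algebras -/

section InverseSystems

variable {k : Type*} [Field k] {r e : ℕ} {κ : DualityAction}

theorem homogeneousComponent_act {G : MvPolynomial (Fin r) k} (hG : G.IsHomogeneous e) {u : ℕ}
    (hu : u ≤ e) (p : MvPolynomial (Fin r) k) :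
    homogeneousComponent (e - u) (act κ p G) = act κ (homogeneousComponent u p) G := by
  have hsum : act κ p G
      = ∑ i ∈ Finset.range (p.totalDegree + 1), act κ (homogeneousComponent i p) G := by
    conv_lhs => rw [← sum_homogeneousComponent p, map_sum, LinearMap.sum_apply]
  have hi : ∀ i, i ≠ u →
      homogeneousComponent (e - u) (act κ (homogeneousComponent i p) G) = 0 := fun i hiu => by
    by_cases hie : e < i
    · rw [act_eq_zero_of_lt (homogeneousComponent_isHomogeneous i p) hG hie, map_zero]
    · rw [homogeneousComponent_of_mem
        (isHomogeneous_act (homogeneousComponent_isHomogeneous i p) hG), if_neg (by omega)]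
  have hu' : homogeneousComponent (e - u) (act κ (homogeneousComponent u p) G)
      = act κ (homogeneousComponent u p) G := homogeneousComponent_eq_self
        (isHomogeneous_act (homogeneousComponent_isHomogeneous u p) hG)
  rw [hsum, map_sum, Finset.sum_eq_single u (fun i _ => hi i), hu']
  intro h
  rw [homogeneousComponent_eq_zero u p (by simpa using h), map_zero, LinearMap.zero_apply, map_zero]

theorem isHomogeneous_Ann {s : ℕ} {G : Fin s → MvPolynomial (Fin r) k}
    (hG : ∀ j, (G j).IsHomogeneous e) :
    (Ann κ (inverseModule κ G)).IsHomogeneous (homogeneousSubmodule (Fin r) k) := by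
  rw [isHomogeneous_iff_homogeneousComponent_mem]
  intro p hp u
  rw [mem_Ann_inverseModule] at hp ⊢
  intro j
  by_cases hu : u ≤ e
  · rw [← homogeneousComponent_act (hG j) hu, hp j, map_zero]
  · exact act_eq_zero_of_lt (homogeneousComponent_isHomogeneous u p) (hG j) (by omega)

theorem hVector_Ann_of_lt {s u : ℕ} {G : Fin s → MvPolynomial (Fin r) k}
    (hG : ∀ j, (G j).IsHomogeneous e) (hu : e < u) : hVector (Ann κ (inverseModule κ G)) u = 0 :=
  hVector_eq_zero_iff.2 fun _ hp =>
    (mem_Ann_inverseModule κ G _).2 fun j => act_eq_zero_of_lt hp (hG j) hu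

theorem hVector_Ann {s u : ℕ} {G : Fin s → MvPolynomial (Fin r) k}
    (hκ : κ = DualityAction.differentiation → ringChar k = 0 ∨ e < ringChar k) (hu : u ≤ e)
    (hG : ∀ j, (G j).IsHomogeneous e) :
    hVector (Ann κ (inverseModule κ G)) u
      = derivDim κ e (Submodule.span k (Set.range G)) u := by
  have h1 := hVector_add_finrank_formsIn (Ann κ (inverseModule κ G)) u
  have h2 := derivDim_add_finrank_ker hκ hu hG
  have h3 : formsIn (Ann κ (inverseModule κ G)) u
      = ⨅ l, LinearMap.ker (derivMap κ G u (Pi.single l 1)) := by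
    ext p
    rw [mem_iInf_ker_derivMap, mem_formsIn, mem_Ann_inverseModule]
  rw [h3] at h1
  omega

/-- Linearly independent forms of degree `e` define a level algebra. -/
theorem isLevel_Ann {c : ℕ} (hc : 1 ≤ c) {G : Fin c → MvPolynomial (Fin r) k}
    (hκ : κ = DualityAction.differentiation → ringChar k = 0 ∨ e < ringChar k)
    (hG : ∀ j, (G j).IsHomogeneous e)
    (hrank : Module.finrank k (Submodule.span k (Set.range G)) = c) :
    IsLevel (Ann κ (inverseModule κ G)) e c := by
  have habove : ∀ u, e < u → hVector (Ann κ (inverseModule κ G)) u = 0 :=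
    fun u => hVector_Ann_of_lt hG
  have htop : hVector (Ann κ (inverseModule κ G)) e = c := by
    rw [hVector_Ann hκ le_rfl hG, derivDim_self, hrank]
  refine ⟨isHomogeneous_Ann hG, isArtinianRing_of_hVector habove, by omega, habove, ?_, ?_⟩
  · rw [socleVector_eq_hVector (habove _ (Nat.lt_succ_self e)), htop]
  · intro u hu
    rw [socleVector_eq_zero_iff]
    intro p hp hX
    rcases lt_or_gt_of_ne hu with hu | hu
    · rw [mem_Ann_inverseModule]
      intro l
      refine eq_zero_of_op_eq_zero hκ (Nat.sub_pos_of_lt hu) (Nat.sub_le e u)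
        (isHomogeneous_act hp (hG l)) fun j => ?_
      have := (mem_Ann_inverseModule κ G _).1 (hX j) l
      rwa [mul_comm, map_mul, Module.End.mul_apply, act_X] at this
    · exact hVector_eq_zero_iff.1 (habove u hu) p hp

/-- A level algebra of socle degree `e` and type `t` is defined by `t` forms of degree `e`: a basis
of the space orthogonal to the forms of degree `e` in the ideal. -/
theorem IsLevel.exists_generators {t : ℕ} {I : Ideal (MvPolynomial (Fin r) k)}
    (hκ : κ = DualityAction.differentiation → ringChar k = 0 ∨ e < ringChar k)
    (hI : IsLevel I e t) :
    ∃ F : Fin t → MvPolynomial (Fin r) k, IsInverseSystemGenerators κ I e F := by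
  let φ := (pairing (k := k) κ e).domRestrict (homogeneousSubmodule (Fin r) k e)
  have hφ : Function.Injective φ := pairing_domRestrict_injective hκ le_rfl le_rfl
  have hsurj : Function.Surjective φ :=
    (LinearMap.injective_iff_surjective_of_finrank_eq_finrank Subspace.dual_finrank_eq.symm).1 hφ
  let T : Submodule k (homogeneousSubmodule (Fin r) k e) := (formsIn I e).dualAnnihilator.comap φ
  have hT : Module.finrank k T = t := by
    have h1 := finrank_map_add_finrank_inf_ker φ T
    rw [LinearMap.ker_eq_bot.2 hφ, inf_bot_eq, finrank_bot, add_zero,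
      Submodule.map_comap_eq_of_surjective hsurj] at h1
    have h2 := Subspace.finrank_add_finrank_dualAnnihilator_eq (formsIn I e)
    have h3 := hVector_add_finrank_formsIn I e
    rw [hI.hVector_top] at h3
    omega
  have : Module.Free k T := Module.Free.of_divisionRing k T
  let b := Module.finBasisOfFinrankEq k T hT
  have hb : ∀ p : homogeneousSubmodule (Fin r) k e, p.1 ∈ I ↔
      ∀ j, coeff 0 (act κ p.1 (b j).1.1) = 0 := fun p => by
    rw [← mem_formsIn, ← Subspace.forall_mem_dualAnnihilator_apply_eq_zero_iff]
    constructor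
    · intro h j
      exact h _ (b j).2
    · intro h ψ hψ
      obtain ⟨Q, rfl⟩ := hsurj ψ
      have hQ := b.sum_repr ⟨Q, hψ⟩
      have hQ' := congrArg (fun x : T => φ x.1 p) hQ
      simp only at hQ'
      rw [← hQ', Submodule.coe_sum, map_sum, LinearMap.sum_apply]
      refine Finset.sum_eq_zero fun j _ => ?_
      rw [Submodule.coe_smul, map_smul, LinearMap.smul_apply]
      have : φ (b j).1 p = 0 := h j
      rw [this, smul_zero]
  have hF : ∀ j, ((b j).1.1 : MvPolynomial (Fin r) k).IsHomogeneous e := fun j => (b j).1.2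
  refine ⟨fun j => (b j).1.1, hF, ideal_eq_of_forms (isHomogeneous_Ann hF) hI.homogeneous ?_⟩
  intro u p hp
  rcases lt_or_ge e u with hu | hu
  · exact iff_of_true (hVector_eq_zero_iff.1 (hVector_Ann_of_lt hF hu) p hp)
      (hVector_eq_zero_iff.1 (hI.above u hu) p hp)
  have hdeg : ∀ q : MvPolynomial (Fin r) k, q.IsHomogeneous (e - u) → (q * p).IsHomogeneous e :=
    fun q hq => by
      have := hq.mul hp
      rwa [Nat.sub_add_cancel hu] at this
  rw [mem_Ann_inverseModule]
  constructor
  · intro h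
    refine hI.mem_of_mul_mem (i := e - u) (by omega) hp fun q hq => ?_
    refine (hb ⟨q * p, hdeg q hq⟩).2 fun j => ?_
    rw [map_mul, Module.End.mul_apply, h j, map_zero, coeff_zero]
  · intro h j
    refine eq_zero_of_coeff_act_eq_zero hκ (Nat.sub_le e u) (isHomogeneous_act hp (hF j))
      fun q hq => ?_
    rw [← Module.End.mul_apply, ← map_mul]
    exact (hb ⟨q * p, hdeg q hq⟩).1 (I.mul_mem_left q h) j

end InverseSystems

/-! ### Generic subspaces of a space of forms -/

section GenericForms

variable {k : Type*} [Field k] {r e t : ℕ} {κ : DualityAction} {F : Fin t → MvPolynomial (Fin r) k}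

theorem isHomogeneous_formsAt {c : ℕ} (hF : ∀ j, (F j).IsHomogeneous e)
    (x : Fin c → Projectivization k (Fin t → k)) (l : Fin c) : (formsAt F x l).IsHomogeneous e :=
  Submodule.sum_mem (homogeneousSubmodule (Fin r) k e) fun j _ => Submodule.smul_mem _ _ (hF j)

theorem isZariskiOpen_of_isMultihomogeneous {c : ℕ} {f : MvPolynomial (Fin c × Fin t) k}
    (hf : IsMultihomogeneous f) :
    IsZariskiOpen {x : Fin c → Projectivization k (Fin t → k) |
      eval (fun q : Fin c × Fin t => (x q.1).rep q.2) f ≠ 0} :=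
  ⟨{f}, by rintro _ rfl; exact hf, by simp⟩

/-- The dimensions of the spaces of derivatives of a `c`-dimensional subspace of `⟨F_1, …, F_t⟩` are
simultaneously maximal on a non-empty Zariski open set. -/
theorem exists_isGenericDerivVector [Infinite k] {c : ℕ} (hct : c ≤ t) (ht : 0 < t)
    (hli : LinearIndependent k F) : ∃ H : ℕ → ℕ, IsGenericDerivVector κ e c F H := by
  choose ρ hle f hf hf0 hfa using fun u => exists_generic_familyRank (derivMap κ F (e - u)) c
  have hfm : IsMultihomogeneous (∏ u ∈ Finset.range (e + 1), f u) := .prod _ hf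
  refine ⟨ρ, _, isZariskiOpen_of_isMultihomogeneous hfm,
    hfm.exists_eval_rep_ne_zero ht (Finset.prod_ne_zero_iff.2 fun u _ => hf0 u), fun x hx => ?_⟩
  have hx' : ∀ u ≤ e, derivDim κ e (Submodule.span k (Set.range (formsAt F x))) u = ρ u :=
    fun u hu => by
      rw [Set.mem_ofPred_eq, map_prod, Finset.prod_ne_zero_iff] at hx
      rw [← hfa u (fun l => (x l).rep) (hx u (Finset.mem_range.2 (by omega))), familyRank_derivMap]
      rfl
  refine ⟨le_antisymm ?_ ?_, hx'⟩
  · exact (finrank_range_le_card (R := k) (formsAt F x)).trans_eq (Fintype.card_fin c)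
  · -- The rank `c` is attained at the first `c` of the forms `F_j`.
    rw [← derivDim_self κ e, hx' e le_rfl]
    refine le_trans (le_of_eq ?_) (hle e fun l => Pi.single (Fin.castLE hct l) 1)
    rw [familyRank_derivMap, derivDim_self]
    have : (fun l => ∑ j, (Pi.single (Fin.castLE hct l) 1 : Fin t → k) j • F j)
        = F ∘ Fin.castLE hct := by
      funext l
      simp [Pi.single_apply]
    rw [this, finrank_span_eq_card (hli.comp _ (Fin.castLE_injective hct)), Fintype.card_fin]

theorem IsGenericDerivVector.bound [Infinite k] {c : ℕ} (hc : 1 ≤ c) (hct : c + 1 ≤ t)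
    (hκ : κ = DualityAction.differentiation → ringChar k = 0 ∨ e < ringChar k)
    (hF : ∀ j, (F j).IsHomogeneous e) {H : ℕ → ℕ} (hH : IsGenericDerivVector κ e c F H) {u : ℕ}
    (hu : u ≤ e) :
    (((t : ℚ) - c) * derivDim κ e (Submodule.span k (Set.range F)) (e - u)
      + ((c : ℚ) * t - 1) * derivDim κ e (Submodule.span k (Set.range F)) u)
      / ((t : ℚ) ^ 2 - 1) ≤ H u := by
  choose ρ hle hρ using exists_generic_familyRank (derivMap κ F (e - u))
  have hHρ : H u = ρ c := by
    obtain ⟨_, ⟨P, hP, rfl⟩, ⟨x₀, g, hg, hx₀⟩, hU⟩ := hH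
    obtain ⟨f, hf, hf0, hfa⟩ := hρ c
    have hg0 : g ≠ 0 := by
      rintro rfl
      simp at hx₀
    obtain ⟨x, hx⟩ := (hf.mul (hP g hg)).exists_eval_rep_ne_zero (by omega) (mul_ne_zero hf0 hg0)
    rw [map_mul, mul_ne_zero_iff] at hx
    rw [← hfa (fun l => (x l).rep) hx.1, familyRank_derivMap, ← (hU x ⟨g, hg, hx.2⟩).2 u hu]
    rfl
  have h := generic_familyRank_bound _ hle hρ hc (by omega : c ≤ t)
  rw [familyRank_derivMap_single] at h
  have h2 := derivDim_add_finrank_ker hκ (Nat.sub_le e u) hF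
  have ht : (0 : ℚ) < (t : ℚ) ^ 2 - 1 := by
    have : (2 : ℚ) ≤ t := by exact_mod_cast (by omega : 2 ≤ t)
    nlinarith
  rw [div_le_iff₀ ht, hHρ, mul_comm (ρ c : ℚ)]
  rw [← h2] at h
  push_cast at h
  rw [add_sub_cancel_right] at h
  exact_mod_cast h

theorem IsGenericHVector.isGenericDerivVector {c : ℕ} {I : Ideal (MvPolynomial (Fin r) k)}
    (hκ : κ = DualityAction.differentiation → ringChar k = 0 ∨ e < ringChar k)
    (hF : ∀ j, (F j).IsHomogeneous e) {H : ℕ → ℕ} (hH : IsGenericHVector κ I e c F H) :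
    IsGenericDerivVector κ e c F H := by
  obtain ⟨U, hU, hne, h⟩ := hH
  refine ⟨U, hU, hne, fun x hx => ?_⟩
  obtain ⟨-, hlev, hh⟩ := h x hx
  have hG := isHomogeneous_formsAt hF x
  refine ⟨?_, fun u hu => ?_⟩
  · have := hlev.hVector_top
    rwa [hVector_Ann hκ le_rfl hG, derivDim_self] at this
  · rw [← hh u, hVector_Ann hκ hu hG]

theorem IsGenericDerivVector.isGenericHVector {c : ℕ} (hc : 1 ≤ c)
    {I : Ideal (MvPolynomial (Fin r) k)}
    (hκ : κ = DualityAction.differentiation → ringChar k = 0 ∨ e < ringChar k)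
    (hF : IsInverseSystemGenerators κ I e F) {H : ℕ → ℕ} (hH : IsGenericDerivVector κ e c F H) :
    IsGenericHVector κ I e c F fun u => if u ≤ e then H u else 0 := by
  obtain ⟨U, hU, hne, h⟩ := hH
  refine ⟨U, hU, hne, fun x hx => ?_⟩
  obtain ⟨hrank, hh⟩ := h x hx
  have hG := isHomogeneous_formsAt hF.1 x
  refine ⟨fun p hp => ?_, isLevel_Ann hc hκ hG hrank, fun u => ?_⟩
  · rw [← hF.2, mem_Ann_inverseModule] at hp
    rw [mem_Ann_inverseModule]
    intro l
    simp [formsAt, hp]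
  · change _ = if u ≤ e then H u else 0
    split_ifs with hu
    · rw [hVector_Ann hκ hu hG, hh u hu]
    · exact hVector_Ann_of_lt hG (by omega)

end GenericForms

end LevelAlgebra

end

theorem theorem2p9 {k : Type*} [Field k] [Infinite k] (r e t c : ℕ)
    (hc : 1 ≤ c) (hct : c + 1 ≤ t) (κ : LevelAlgebra.DualityAction)
    (hκ : κ = LevelAlgebra.DualityAction.differentiation → ringChar k = 0 ∨ e < ringChar k) :
    (∀ I : Ideal (MvPolynomial (Fin r) k), LevelAlgebra.IsLevel I e t →
      (∃ F : Fin t → MvPolynomial (Fin r) k, LevelAlgebra.IsInverseSystemGenerators κ I e F) ∧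
      ∀ F : Fin t → MvPolynomial (Fin r) k, LevelAlgebra.IsInverseSystemGenerators κ I e F →
        (∀ u ≤ e, LevelAlgebra.hVector I u
          = LevelAlgebra.derivDim κ e (Submodule.span k (Set.range F)) u) ∧
        (∀ H : ℕ → ℕ, LevelAlgebra.IsGenericHVector κ I e c F H →
          LevelAlgebra.IsGenericDerivVector κ e c F H) ∧
        (∃ H : ℕ → ℕ, LevelAlgebra.IsGenericHVector κ I e c F H) ∧
        ∀ H : ℕ → ℕ, LevelAlgebra.IsGenericHVector κ I e c F H → ∀ u ≤ e,
          (((t : ℚ) - c) * LevelAlgebra.hVector I (e - u)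
              + ((c : ℚ) * t - 1) * LevelAlgebra.hVector I u) / ((t : ℚ) ^ 2 - 1) ≤ H u ∧
          (c = t - 1 →
            ((LevelAlgebra.hVector I (e - u) : ℚ)
              + ((t : ℚ) ^ 2 - t - 1) * LevelAlgebra.hVector I u) / ((t : ℚ) ^ 2 - 1) ≤ H u)) ∧
    (∀ F : Fin t → MvPolynomial (Fin r) k, (∀ j, (F j).IsHomogeneous e) → LinearIndependent k F →
      (∃ H : ℕ → ℕ, LevelAlgebra.IsGenericDerivVector κ e c F H) ∧
      ∀ H : ℕ → ℕ, LevelAlgebra.IsGenericDerivVector κ e c F H → ∀ u ≤ e,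
        (((t : ℚ) - c) * LevelAlgebra.derivDim κ e (Submodule.span k (Set.range F)) (e - u)
            + ((c : ℚ) * t - 1) * LevelAlgebra.derivDim κ e (Submodule.span k (Set.range F)) u)
            / ((t : ℚ) ^ 2 - 1) ≤ H u ∧
        (c = t - 1 →
          ((LevelAlgebra.derivDim κ e (Submodule.span k (Set.range F)) (e - u) : ℚ)
            + ((t : ℚ) ^ 2 - t - 1)
              * LevelAlgebra.derivDim κ e (Submodule.span k (Set.range F)) u)
            / ((t : ℚ) ^ 2 - 1) ≤ H u)) := by
  have hcast : c = t - 1 → (c : ℚ) = t - 1 := fun h => by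
    rw [h, Nat.cast_sub (by omega), Nat.cast_one]
  have hlast : ∀ a b x : ℚ, (((t : ℚ) - c) * a + ((c : ℚ) * t - 1) * b) / ((t : ℚ) ^ 2 - 1) ≤ x →
      (((t : ℚ) - c) * a + ((c : ℚ) * t - 1) * b) / ((t : ℚ) ^ 2 - 1) ≤ x ∧
      (c = t - 1 → (a + ((t : ℚ) ^ 2 - t - 1) * b) / ((t : ℚ) ^ 2 - 1) ≤ x) := by
    refine fun a b x h => ⟨h, fun hc' => ?_⟩
    rw [hcast hc'] at h
    convert h using 2
    ring
  refine ⟨fun I hI => ⟨hI.exists_generators hκ, fun F hF => ?_⟩, fun F hF hli =>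
    ⟨LevelAlgebra.exists_isGenericDerivVector (by omega) (by omega) hli,
      fun H hH u hu => hlast _ _ _ (hH.bound hc hct hκ hF hu)⟩⟩
  have hh : ∀ u ≤ e, LevelAlgebra.hVector I u
      = LevelAlgebra.derivDim κ e (Submodule.span k (Set.range F)) u := fun u hu => by
    rw [← hF.2, LevelAlgebra.hVector_Ann hκ hu hF.1]
  have hli : LinearIndependent k F := by
    rw [linearIndependent_iff_card_eq_finrank_span, Fintype.card_fin, Set.finrank,
      ← LevelAlgebra.derivDim_self κ e, ← hh e le_rfl, hI.hVector_top]
  refine ⟨hh, fun H hH => hH.isGenericDerivVector hκ hF.1, ?_, fun H hH u hu => ?_⟩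
  · obtain ⟨H, hH⟩ := LevelAlgebra.exists_isGenericDerivVector (κ := κ) (e := e) (c := c)
      (by omega) (by omega) hli
    exact ⟨_, hH.isGenericHVector hc hκ hF⟩
  · rw [hh u hu, hh (e - u) (Nat.sub_le e u)]
    exact hlast _ _ _ ((hH.isGenericDerivVector hκ hF.1).bound hc hct hκ hF.1 hu)
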